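/- **Setting.** Let $G=(V,E)$ be a connected $n$-vertex CONGEST network whose vertices have distinct identities of $O(\log n)$ bits. Let $H\subseteq G$ have distinct edge weights ($H=G$ for the MST problem, a general $H$ for the spanning forest problem). Vertex-disjoint fragments are given, each partitioned into base fragments; a vertex outside all fragments lies in a small component, which no edge of $H$ leaves. Each fragment has a leader vertex, whose identity serves as the identity of the fragment. The minimum-weight outgoing edge (MWOE) of a fragment is its lightest outgoing edge in $H$; a fragment without outgoing edges in $H$ is *terminated*. The parent of a fragment is the fragment at the other end of its MWOE, except that, of two fragments with the same MWOE, the one with the larger identity is a root. This defines the *virtual forest*. Initially every vertex of a fragment knows its own identity, whether it is the leader, the identity of its fragment and of the fragment's parent (if any), and, for each of its ports, whether the MWOE of its fragment goes through it. **Communication cycles.** There are a BFS tree $T$ of $G$ of depth $d(T)$, spanning trees in $G$ of the $K_b$ base fragments, and time slots in $\{1,\dots,2K_b\}$: a fragment with $k$ base fragments owns $k+1$ consecutive slots, disjoint from those of all other fragments; the first is its publishing slot, and the others are the query slots of its base fragments. In both cycles a vertex at depth $d$ of $T$ upcasts the messages of slot $i$ in round $d(T)+i-d$, and the messages sent by the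 root of $T$ are routed down $T$ by routing labels. In a *convergecast cycle*, inputs are aggregated over the spanning trees of the base fragments; the roots of these inject the partial outcomes, with the label of the leader, in the publishing slot of their fragment; $T$ aggregates them and its root sends the outcome to the leader. In a *broadcast cycle*, each leader upcasts a message in its publishing slot and each base fragment root upcasts its own label in its query slot; the root of $T$ stores the last published message and sends it in response to each query; the base fragment roots then broadcast what they received over their trees. Inputs and messages are local functions of the states and port buffers of the vertices. In a *round over MWOEs*, vertices send messages over MWOEs only. **Claim.** 1. There is an absolute constant $C$ such that each of the following virtual rounds, with $O(\log n)$-bit messages, can be simulated with at most $C$ communication cycles and at most $C$ rounds over MWOEs, with $O(\log n)$-bit messages and $O(\log n)$ additional bits of memory per vertex: (i) every parent sends a message to all its children; (ii) every parent sends a message to one arbitrary child; (iii) every child sends a message to its parent, and the messages received by a parent are aggregated with a commutative semigroup operation. Here *simulated* means: if every vertex of each fragment has a copy of the state of its fragment before the virtual round, then it has a copy of the new state of its fragment (a possible one, in case (ii)) afterwards. The simulating algorithm depends on $n$, the sizes of identities and messages, the state space and the virtual round, but not on the network. 2. Consequently, a GKP phase on the virtual forest can be carried out with $O(\log^* n)$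 virtual rounds of these three kinds and $O(\log n)$-bit states and messages; and it can be carried out with $O(\log^* n)$ communication cycles and $O(\log^* n)$ rounds over MWOEs, with messages of $O(\log n)$ bits, $O(\log n)$ bits of working memory per vertex beyond what the cycles themselves use, and $O(K\log^* n)$ messages sent over MWOEs outside the cycles, where $K$ is the number of fragments. The constants depend only on the constant in the size of the identities. (For $n=1$, read $\log^* n$ as $1$.) A GKP phase computes on the virtual forest: a proper $3$-coloring; a maximal matching; and, for every unmatched fragment that is not terminated, an adjacent matched fragment to which it attaches. The matching edges and attachment edges partition the virtual forest into subtrees of depth at most $3$, and every fragment that is not terminated lies in a subtree with more than one fragment. Each vertex of a fragment ends up knowing its fragment's color and the identities of its fragment's mate and of the fragment it attaches to, if any. -/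

import Mathlib

/-! Communication cycles on a CONGEST network whose vertices are grouped into fragments, the virtual
forest formed by the minimum-weight outgoing edges (MWOEs), virtual rounds on that forest, and the
GKP phase. -/

/-- The iterated logarithm to base `2`: how often `⌈log₂ ·⌉` has to be applied to `n` until the value
is at most `1`.  (Rounding up does not change the value of the usual real iterated logarithm.) -/
def logStar (n : ℕ) : ℕ :=
  if h : n ≤ 1 then 0 else
    have : Nat.clog 2 n < n := by
      have h1 : Nat.clog 2 n ≤ n - 1 := by
        apply Nat.clog_le_of_le_pow
        have := Nat.lt_two_pow_self (n := n - 1)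
        omega
      omega
    logStar (Nat.clog 2 n) + 1
termination_by n

/-- The number of bits that is called `log n`; it is at least `1`. -/
def logBits (n : ℕ) : ℕ := Nat.log 2 n + 1

/-! ### Aggregation -/

/-- Aggregate of two inputs, either of which may be missing. -/
noncomputable def combine {M : Type} (op : CommSemigroup M) (x y : Option M) : Option M :=
  letI := op
  ((show WithOne M from x) * (show WithOne M from y) : WithOne M)

/-- Aggregate, with respect to the semigroup operation `op`, of those `x i`, `i ∈ A`, that are
present; it is `none` if there are none. -/
noncomputable def aggregate {M : Type} (op : CommSemigroup M) {ι : Type} (A : Finset ι)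
    (x : ι → Option M) : Option M :=
  letI := op
  (∏ i ∈ A, (show WithOne M from x i) : WithOne M)

/-- Aggregation of pairs `⟨value, label⟩`: values are aggregated with `op`, and the label is copied
from one of the two messages. -/
@[reducible] def pairOp {M : Type} (op : CommSemigroup M) : CommSemigroup (M × ℕ) :=
  letI := op
  { mul := fun a b => (a.1 * b.1, min a.2 b.2)
    mul_assoc := fun a b c => Prod.ext (mul_assoc a.1 b.1 c.1) (min_assoc a.2 b.2 c.2)
    mul_comm := fun a b => Prod.ext (mul_comm a.1 b.1) (min_comm a.2 b.2) }

open scoped Classical in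
/-- The message carried by a link on which `s` has been put: it is lost unless it is alone. -/
noncomputable def single {α : Type} (s : Multiset α) : Option α :=
  if h : ∃ a, s = {a} then some h.choose else none

/-! ### Networks -/

/-- A network with vertex set `V` at the beginning of a phase: the fragments (indexed by `F`), their
partition into base fragments (indexed by `B`), their MWOEs, and what communication cycles require,
namely a BFS tree, spanning trees of the base fragments, leaders and time slots. -/
structure Network (V F B : Type) [Fintype V] [Fintype F] [Fintype B] where
  /-- the communication graph -/
  G : SimpleGraph V
  conn : G.Connected
  /-- the edges that may be used by the spanning forest (`H = G` for the MST problem) -/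
  H : SimpleGraph V
  H_le : H ≤ G
  /-- edge weights -/
  w : Sym2 V → ℝ
  w_inj : Set.InjOn w H.edgeSet
  /-- vertex identities -/
  id : V → ℕ
  id_inj : Function.Injective id
  /-- root of the BFS tree `T` -/
  root : V
  /-- parent pointers of `T` -/
  up : V → V
  up_root : up root = root
  up_adj : ∀ v, v ≠ root → G.Adj v (up v)
  up_dist : ∀ v, v ≠ root → G.dist root (up v) + 1 = G.dist root v
  /-- the base fragment of a vertex; `none` for the vertices of small components -/
  base : V → Option B
  /-- the fragment that contains a base fragment -/
  part : B → F
  /-- no edge of `H` joins a small component to another component -/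
  base_closed : ∀ a b, H.Adj a b → (base a = none ↔ base b = none)
  /-- root of the spanning tree of a base fragment -/
  baseRoot : B → V
  base_baseRoot : ∀ b, base (baseRoot b) = some b
  /-- parent pointers of the spanning trees of the base fragments -/
  baseUp : V → V
  /-- depth in the spanning tree of the own base fragment -/
  baseDepth : V → ℕ
  baseDepth_root : ∀ b, baseDepth (baseRoot b) = 0
  baseUp_spec : ∀ v b, base v = some b → v ≠ baseRoot b →
    G.Adj v (baseUp v) ∧ base (baseUp v) = some b ∧ baseDepth (baseUp v) + 1 = baseDepth v
  /-- the leader vertex of a fragment -/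
  leader : F → V
  leader_mem : ∀ f, (base (leader f)).map part = some f
  /-- the publishing slot of a fragment -/
  pslot : F → ℕ
  /-- the query slot of a base fragment -/
  qslot : B → ℕ
  pslot_pos : ∀ f, 1 ≤ pslot f
  pslot_le : ∀ f, pslot f + Nat.card {b : B // part b = f} ≤ 2 * Fintype.card B
  slots_disjoint : ∀ f g, f ≠ g →
    pslot f + Nat.card {b : B // part b = f} < pslot g ∨
      pslot g + Nat.card {b : B // part b = g} < pslot f
  qslot_mem : ∀ b, pslot (part b) < qslot b ∧
    qslot b ≤ pslot (part b) + Nat.card {b' : B // part b' = part b}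
  qslot_inj : ∀ b b', part b = part b' → qslot b = qslot b' → b = b'
  /-- the MWOE of a fragment, oriented outwards; `none` if the fragment is terminated -/
  mwoe : F → Option (V × V)
  mwoe_some : ∀ f a b, mwoe f = some (a, b) →
    H.Adj a b ∧ (base a).map part = some f ∧ (base b).map part ≠ some f ∧
      ∀ a' b', H.Adj a' b' → (base a').map part = some f → (base b').map part ≠ some f →
        w s(a, b) ≤ w s(a', b')
  mwoe_none : ∀ f, mwoe f = none →
    ∀ a b, H.Adj a b → (base a).map part = some f → (base b).map part = some f

/-- What a vertex knows at the beginning about itself and its fragment (all its fields are vertex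
identities or single bits). -/
structure Info where
  /-- own identity -/
  id : ℕ
  /-- is the vertex the leader of its fragment? -/
  isLeader : Prop
  /-- identity of the own fragment -/
  fid : ℕ
  /-- identity of the parent of the own fragment in the virtual forest -/
  parentFid : Option ℕ

namespace Network

variable {V F B : Type} [Fintype V] [Fintype F] [Fintype B] (N : Network V F B)

/-- The fragment of a vertex. -/
def frag (v : V) : Option F := (N.base v).map N.part

/-- The identity of a fragment is that of its leader. -/
def fid (f : F) : ℕ := N.id (N.leader f)

open scoped Classical in
/-- The parent of `f` in the virtual forest is the fragment on the other side of the MWOE of `f`;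
if two fragments have the same MWOE, then the one with the larger identity is a root. -/
noncomputable def parent (f : F) : Option F :=
  match N.mwoe f with
  | none => none
  | some (a, b) =>
    match N.frag b with
    | none => none
    | some g => if N.mwoe g = some (b, a) ∧ N.fid g < N.fid f then none else some g

open scoped Classical in
/-- The children of `f` in the virtual forest. -/
noncomputable def children (f : F) : Finset F := Finset.univ.filter fun g => N.parent g = some f

/-- `f` and `g` are adjacent in the virtual forest. -/
def VAdj (f g : F) : Prop := N.parent f = some g ∨ N.parent g = some f

/-- The link from `u` to `v` is the MWOE of the fragment of `u`. -/
def OwnPort (u v : V) : Prop := ∃ f, N.frag u = some f ∧ N.mwoe f = some (u, v)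

/-- The initial knowledge of a vertex `v` of the fragment `f`. -/
noncomputable def info (v : V) (f : F) : Info where
  id := N.id v
  isLeader := v = N.leader f
  fid := N.fid f
  parentFid := (N.parent f).map N.fid

/-! ### The two communication cycles

One step of the time variable `t` is one round with messages that may carry a routing label.  The
routing label of a vertex is represented by its identity, and a labelled message that has left the
root of `T` follows the path of `T` to its destination. -/

/-- Depth in the BFS tree. -/
noncomputable def depth (v : V) : ℕ := N.G.dist N.root v

/-- Depth of the BFS tree. -/
noncomputable def treeDepth : ℕ := Finset.univ.sup N.depth

/-- Maximal depth of a spanning tree of a base fragment. -/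
noncomputable def maxBaseDepth : ℕ :=
  Finset.univ.sup fun v => match N.base v with
    | some _ => N.baseDepth v
    | none => 0

open scoped Classical in
/-- The children of `v` in the BFS tree. -/
noncomputable def treeChildren (v : V) : Finset V :=
  Finset.univ.filter fun c => c ≠ N.root ∧ N.up c = v

open scoped Classical in
/-- The children of `v` in the spanning tree of its base fragment. -/
noncomputable def baseChildren (v : V) : Finset V :=
  Finset.univ.filter fun c => ∃ b, N.base c = some b ∧ c ≠ N.baseRoot b ∧ N.baseUp c = v

section

variable {M : Type}

/-- Intrinsic step of a convergecast cycle: every vertex aggregates its own input and what it gets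
from its children in the spanning tree of the base fragment, and sends the result to its parent.
The value at `v` is the result at `v` if the number `k` is at least the height of `v`. -/
noncomputable def intrinsicUp (op : CommSemigroup M) (x : V → Option M) : ℕ → V → Option M
  | 0, v => x v
  | k + 1, v => combine op (x v) (aggregate op (N.baseChildren v) (intrinsicUp op x k))

open scoped Classical in
/-- What `v` injects in round `t` of the extrinsic step: the root of a base fragment injects the
partial outcome with the label of its leader, in the round in which the window of the slot of its
fragment is at its depth. -/
noncomputable def inject (op : CommSemigroup M) (x : V → Option M) (t : ℕ) (v : V) :
    Option (M × ℕ) :=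
  match N.base v with
  | none => none
  | some b =>
    if v = N.baseRoot b ∧ t + N.depth v = N.pslot (N.part b) + N.treeDepth then
      (N.intrinsicUp op x N.maxBaseDepth v).map fun m => (m, N.fid (N.part b))
    else none

/-- The message that `v` sends up the BFS tree in round `t`: the aggregate of what it injects and
of all that its children sent in the preceding round. -/
noncomputable def upcast (op : CommSemigroup M) (x : V → Option M) : ℕ → V → Option (M × ℕ)
  | 0, _ => none
  | t + 1, v => combine (pairOp op) (N.inject op x (t + 1) v)
      (aggregate (pairOp op) (N.treeChildren v) (upcast op x t))

open scoped Classical in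
/-- The labelled message that is at `v` in round `t` on its way down, if in round `s` the root of
the BFS tree dispatches the message `out s`. -/
noncomputable def down (out : ℕ → Option (M × ℕ)) : ℕ → V → Option (M × ℕ)
  | 0, v => if v = N.root then out 0 else none
  | t + 1, v =>
    if v = N.root then out (t + 1) else
      match down out t (N.up v) with
      | none => none
      | some (m, l) => if ∃ x k, N.id x = l ∧ N.up^[k] x = v then some (m, l) else none

/-- The message that has been delivered to `v` when the extrinsic step is over. -/
noncomputable def delivered (out : ℕ → Option (M × ℕ)) (v : V) : Option M :=
  (List.range (2 * N.treeDepth + 2 * Fintype.card B + 1)).findSome? fun t =>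
    match N.down out t v with
    | none => none
    | some (m, l) => if l = N.id v then some m else none

/-- What `v` has received at the end of a convergecast cycle with inputs `x`. -/
noncomputable def convergecastResult (op : CommSemigroup M) (x : V → Option M) (v : V) :
    Option M :=
  N.delivered (fun t => N.upcast op x t N.root) v

/-- The two types of messages of the extrinsic step of a broadcast cycle. -/
inductive PQ (M : Type) where
  /-- the message of a leader -/
  | publish (m : M)
  /-- the request of the root of a base fragment, with its routing label -/
  | query (label : ℕ)

open scoped Classical in
/-- What `v` injects in round `t` of a broadcast cycle in which `x v` is the message of `v` if `v`
is a leader. -/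
noncomputable def injectPQ (x : V → M) (t : ℕ) (v : V) : Multiset (PQ M) :=
  match N.base v with
  | none => 0
  | some b =>
    (if v = N.leader (N.part b) ∧ t + N.depth v = N.pslot (N.part b) + N.treeDepth then
      {PQ.publish (x v)} else 0) +
    (if v = N.baseRoot b ∧ t + N.depth v = N.qslot b + N.treeDepth then
      {PQ.query (N.id v)} else 0)

/-- The message that `v` sends up the BFS tree in round `t` of a broadcast cycle; messages that
meet at a vertex in the same round are lost. -/
noncomputable def upcastPQ (x : V → M) : ℕ → V → Option (PQ M)
  | 0, _ => none
  | t + 1, v => single (N.injectPQ x (t + 1) v +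
      ∑ c ∈ N.treeChildren v, (match upcastPQ x t c with
        | none => 0
        | some m => {m}))

/-- The variable in which the root of the BFS tree stores the last published message. -/
noncomputable def stored (x : V → M) : ℕ → Option M
  | 0 => none
  | t + 1 => match N.upcastPQ x (t + 1) N.root with
    | some (PQ.publish m) => some m
    | _ => stored x t

/-- The response that the root of the BFS tree sends in round `t`. -/
noncomputable def response (x : V → M) (t : ℕ) : Option (M × ℕ) :=
  match N.upcastPQ x t N.root with
  | some (PQ.query l) => (N.stored x t).map fun m => (m, l)
  | _ => none

open scoped Classical in
/-- Intrinsic step of a broadcast cycle: what `v` has got after `k` rounds of passing on the message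
`y` of the root of the base fragment. -/
noncomputable def intrinsicDown (y : V → Option M) : ℕ → V → Option M
  | 0, v => if ∃ b, v = N.baseRoot b then y v else none
  | k + 1, v => if ∃ b, v = N.baseRoot b then y v else
      match N.base v with
      | none => none
      | some _ => intrinsicDown y k (N.baseUp v)

/-- What `v` has received at the end of a broadcast cycle. -/
noncomputable def broadcastResult (x : V → M) (v : V) : Option M :=
  N.intrinsicDown (N.delivered (N.response x)) N.maxBaseDepth v

end

end Network

/-! ### Algorithms that use communication cycles -/

/-- One step of a distributed algorithm with state space `σ` at every vertex and messages in `M`.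
All functions are local: they see the state of one vertex and the buffer of one port at a time, and
whether this port leads to the MWOE of the own fragment. -/
inductive CStep (σ M : Type) where
  /-- A convergecast cycle: a vertex contributes its own input and one input for every message in
  the buffers of its ports; the leader of each fragment gets the aggregate. -/
  | convergecast (op : CommSemigroup M) (own : σ → Option M) (port : σ → Prop → M → Option M)
      (upd : σ → Option M → σ)
  /-- A broadcast cycle: the leader of each fragment sends a message, all vertices of the fragment
  get it. -/
  | broadcast (msg : σ → M) (upd : σ → M → σ)
  /-- A round of messages over MWOEs: for each port, the message to send depends on the content of
  the buffer of the port.  The new messages replace the contents of all buffers. -/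
  | round (send : σ → Prop → Option M → Option M)

/-- The states of the vertices; `buf v u` is what `v` finds in the buffer of its port to `u`. -/
structure Conf (V σ M : Type) where
  st : V → σ
  buf : V → V → Option M

namespace CStep

variable {V F B : Type} [Fintype V] [Fintype F] [Fintype B] {σ M : Type}

open scoped Classical in
/-- The message sent from `u` to `v` in a round over MWOEs. -/
noncomputable def sent (N : Network V F B) (send : σ → Prop → Option M → Option M)
    (c : Conf V σ M) (u v : V) : Option M :=
  if N.frag u ≠ none ∧ N.G.Adj u v then send (c.st u) (N.OwnPort u v) (c.buf u v) else none

open scoped Classical in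
/-- The input of `v` to a convergecast cycle. -/
noncomputable def input (N : Network V F B) (op : CommSemigroup M) (own : σ → Option M)
    (port : σ → Prop → M → Option M) (c : Conf V σ M) (v : V) : Option M :=
  combine op (own (c.st v))
    (aggregate op (Finset.univ.filter fun u => N.G.Adj v u)
      fun u => (c.buf v u).bind (port (c.st v) (N.OwnPort v u)))

open scoped Classical in
/-- The effect of a step. -/
noncomputable def exec (N : Network V F B) (c : Conf V σ M) : CStep σ M → Conf V σ M
  | convergecast op own port upd =>
    ⟨fun v =>
      if ∃ f, v = N.leader f then
        upd (c.st v) (N.convergecastResult op (input N op own port c) v)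
      else c.st v, c.buf⟩
  | broadcast msg upd =>
    ⟨fun v =>
      match N.broadcastResult (fun u => msg (c.st u)) v with
      | none => c.st v
      | some m => upd (c.st v) m, c.buf⟩
  | round send => ⟨c.st, fun v u => sent N send c u v⟩

/-- In a round over MWOEs, all messages are sent over MWOEs. -/
def Legal (N : Network V F B) (c : Conf V σ M) : CStep σ M → Prop
  | round send => ∀ u v, sent N send c u v ≠ none → N.OwnPort u v ∨ N.OwnPort v u
  | _ => True

open scoped Classical in
/-- The number of messages sent over MWOEs outside of the communication cycles. -/
noncomputable def messages (N : Network V F B) (c : Conf V σ M) : CStep σ M → ℕ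
  | round send => (Finset.univ.filter fun e : V × V => sent N send c e.1 e.2 ≠ none).card
  | _ => 0

/-- The cost of a step in communication cycles. -/
def cycles : CStep σ M → ℕ
  | round _ => 0
  | _ => 1

/-- The cost of a step in additional rounds over MWOEs. -/
def rounds : CStep σ M → ℕ
  | round _ => 1
  | _ => 0

/-- The effect of a sequence of steps. -/
noncomputable def execAll (N : Network V F B) : Conf V σ M → List (CStep σ M) → Conf V σ M
  | c, [] => c
  | c, s :: P => execAll N (exec N c s) P

/-- All messages outside of the communication cycles are sent over MWOEs. -/
def LegalAll (N : Network V F B) : Conf V σ M → List (CStep σ M) → Prop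
  | _, [] => True
  | c, s :: P => Legal N c s ∧ LegalAll N (exec N c s) P

/-- The number of messages sent outside of the communication cycles. -/
noncomputable def messagesAll (N : Network V F B) : Conf V σ M → List (CStep σ M) → ℕ
  | _, [] => 0
  | c, s :: P => messages N c s + messagesAll N (exec N c s) P

end CStep

/-! ### Virtual rounds -/

/-- One round on the virtual forest, whose nodes have states in `σ` and send messages in `M`. -/
inductive VStep (σ M : Type) where
  /-- each parent sends one message to all its children -/
  | toChildren (msg : σ → M) (upd : σ → Option M → σ)
  /-- each parent sends a message to one arbitrary child -/
  | toOneChild (msg : σ → M) (upd : σ → Option M → σ)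
  /-- each child sends a message to its parent, which gets the aggregate -/
  | toParent (op : CommSemigroup M) (msg : σ → M) (upd : σ → Option M → σ)

namespace VStep

variable {V F B : Type} [Fintype V] [Fintype F] [Fintype B] {σ M : Type}

/-- `s'` is a possible outcome of a virtual round that starts in the states `s`.  A node that
receives nothing is updated with `none`. -/
def Result (N : Network V F B) : VStep σ M → (F → σ) → (F → σ) → Prop
  | toChildren msg upd, s, s' =>
    ∀ f, s' f = upd (s f) ((N.parent f).map fun g => msg (s g))
  | toOneChild msg upd, s, s' =>
    ∃ sel : F → Option F,
      (∀ g f, sel g = some f → N.parent f = some g) ∧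
      (∀ g, (∃ f, N.parent f = some g) → sel g ≠ none) ∧
      ∀ f, (∀ g, sel g = some f → s' f = upd (s f) (some (msg (s g)))) ∧
        ((∀ g, sel g ≠ some f) → s' f = upd (s f) none)
  | toParent op msg upd, s, s' =>
    ∀ g, s' g = upd (s g) (aggregate op (N.children g) fun f => some (msg (s f)))

/-- `s'` is a possible outcome of a sequence of virtual rounds that starts in the states `s`. -/
def ResultAll (N : Network V F B) : List (VStep σ M) → (F → σ) → (F → σ) → Prop
  | [], s, s' => s' = s
  | st :: P, s, s' => ∃ t, Result N st s t ∧ ResultAll N P t s'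

end VStep

/-- Every vertex of a fragment `f` has a copy of the state `s f` of its fragment (next to its own
initial knowledge), in the encoding `enc`. -/
def HoldsCopies {V F B : Type} [Fintype V] [Fintype F] [Fintype B] (N : Network V F B)
    {σ σ' M' : Type} (enc : Info → σ → σ') (s : F → σ) (c : Conf V σ' M') : Prop :=
  ∀ v f, N.frag v = some f → c.st v = enc (N.info v f) (s f)

/-- The network has `n` vertices, with identities of at most `a * log n` bits. -/
def HasSize {V F B : Type} [Fintype V] [Fintype F] [Fintype B] (N : Network V F B)
    (n a : ℕ) : Prop :=
  Fintype.card V = n ∧ ∀ v, N.id v < 2 ^ (a * logBits n)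

/-- On networks with `n` vertices and identities of at most `a * log n` bits, the sequence `P` of
steps simulates the virtual round `st`: if every vertex has a copy of the state of its fragment
before, then it has a copy of the new state of its fragment afterwards. -/
def Simulates (n a : ℕ) {σ M σ' M' : Type} (enc : Info → σ → σ') (P : List (CStep σ' M'))
    (st : VStep σ M) : Prop :=
  ∀ (V F B : Type) [Fintype V] [Fintype F] [Fintype B] (N : Network V F B), HasSize N n a →
    ∀ (s : F → σ) (c : Conf V σ' M'), HoldsCopies N enc s c →
      CStep.LegalAll N c P ∧
      ∃ s', st.Result N s s' ∧ HoldsCopies N enc s' (CStep.execAll N c P)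

/-! ### The GKP phase -/

/-- What a fragment knows at the end: its color, the identity of the fragment it is matched with,
and the identity of the fragment it attaches to. -/
structure GKPOutput where
  color : Fin 3
  mate : Option ℕ
  attach : Option ℕ

/-- The subtrees into which the virtual forest is partitioned: the edges are those of the matching
and those by which unmatched fragments attach. -/
def joinGraph {F : Type} (mate attach : F → Option F) : SimpleGraph F :=
  SimpleGraph.fromRel fun f g => mate f = some g ∨ attach f = some g

/-- The result of a GKP phase. -/
structure IsGKPPartition {V F B : Type} [Fintype V] [Fintype F] [Fintype B] (N : Network V F B)
    (color : F → Fin 3) (mate attach : F → Option F) : Prop where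
  proper : ∀ f g, N.VAdj f g → color f ≠ color g
  mate_symm : ∀ f g, mate f = some g → mate g = some f
  mate_adj : ∀ f g, mate f = some g → N.VAdj f g
  maximal : ∀ f g, N.VAdj f g → mate f ≠ none ∨ mate g ≠ none
  attach_matched : ∀ f, mate f ≠ none → attach f = none
  attach_adj : ∀ f g, attach f = some g → N.VAdj f g ∧ mate g ≠ none
  attach_unmatched : ∀ f, mate f = none → N.mwoe f ≠ none → attach f ≠ none
  /-- every fragment that is not terminated belongs to a subtree with more than one node -/
  nontrivial : ∀ f, N.mwoe f ≠ none → ∃ g, (joinGraph mate attach).Adj f g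
  /-- the subtrees have depth at most `3` -/
  shallow : ∀ f g, (joinGraph mate attach).Reachable f g → (joinGraph mate attach).dist f g ≤ 3

/-- The outputs `out f` describe the result of a GKP phase. -/
def IsGKPOutput {V F B : Type} [Fintype V] [Fintype F] [Fintype B] (N : Network V F B)
    (out : F → GKPOutput) : Prop :=
  ∃ (color : F → Fin 3) (mate attach : F → Option F), IsGKPPartition N color mate attach ∧
    ∀ f, out f = ⟨color f, (mate f).map N.fid, (attach f).map N.fid⟩

/-! ### Aggregates as products -/

/-- Optional messages form a commutative monoid in which `none` is the unit. -/
@[reducible] noncomputable def optionMonoid {M : Type} (op : CommSemigroup M) :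
    CommMonoid (Option M) where
  mul := combine op
  one := none
  mul_assoc x y z := letI := op; mul_assoc (show WithOne M from x) y z
  mul_comm x y := letI := op; mul_comm (show WithOne M from x) y
  one_mul x := letI := op; one_mul (show WithOne M from x)
  mul_one x := letI := op; mul_one (show WithOne M from x)

section Aggregation

variable {M M' ι κ : Type}

theorem combine_none_left (op : CommSemigroup M) (y : Option M) : combine op none y = y :=
  (optionMonoid op).one_mul y

theorem combine_none_right (op : CommSemigroup M) (x : Option M) : combine op x none = x :=
  (optionMonoid op).mul_one x

theorem combine_some_some (op : CommSemigroup M) (x y : M) :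
    combine op (some x) (some y) = some (op.mul x y) := rfl

theorem aggregate_eq_prod (op : CommSemigroup M) (A : Finset ι) (x : ι → Option M) :
    letI := optionMonoid op
    aggregate op A x = ∏ i ∈ A, x i := rfl

theorem aggregate_empty (op : CommSemigroup M) (x : ι → Option M) : aggregate op ∅ x = none := rfl

theorem aggregate_insert [DecidableEq ι] (op : CommSemigroup M) {A : Finset ι} {i : ι} (hi : i ∉ A)
    (x : ι → Option M) : aggregate op (insert i A) x = combine op (x i) (aggregate op A x) := by
  let := optionMonoid op
  exact Finset.prod_insert hi

/-- Aggregation commutes with maps that are compatible with `combine`. -/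
theorem aggregate_comp (op : CommSemigroup M) (op' : CommSemigroup M')
    (φ : Option M → Option M') (h0 : φ none = none)
    (hφ : ∀ x y, φ (combine op x y) = combine op' (φ x) (φ y)) (A : Finset ι) (x : ι → Option M) :
    φ (aggregate op A x) = aggregate op' A fun i => φ (x i) := by
  classical
  induction A using Finset.induction_on with
  | empty => simpa [aggregate_empty] using h0
  | insert i A hi ih => rw [aggregate_insert _ hi, aggregate_insert _ hi, hφ, ih]

/-- With a selective operation, the aggregate is one of the inputs. -/
theorem aggregate_selects (op : CommSemigroup M) (hop : ∀ a b, op.mul a b = a ∨ op.mul a b = b)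
    (A : Finset ι) (x : ι → Option M) :
    (aggregate op A x = none → ∀ i ∈ A, x i = none) ∧
      ∀ m, aggregate op A x = some m → ∃ i ∈ A, x i = some m := by
  classical
  induction A using Finset.induction_on with
  | empty => simp [aggregate_empty]
  | insert i A hi ih =>
    rw [aggregate_insert _ hi]
    cases hx : x i with
    | none =>
      rw [combine_none_left]
      refine ⟨fun h j hj => ?_, fun m hm => ?_⟩
      · rcases Finset.mem_insert.1 hj with rfl | hj
        · exact hx
        · exact ih.1 h j hj
      · obtain ⟨j, hj, hjm⟩ := ih.2 m hm
        exact ⟨j, Finset.mem_insert_of_mem hj, hjm⟩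
    | some a =>
      cases hA : aggregate op A x with
      | none =>
        rw [combine_none_right]
        refine ⟨by simp, fun m hm => ⟨i, Finset.mem_insert_self _ _, ?_⟩⟩
        rw [hx, hm]
      | some b =>
        rw [combine_some_some]
        refine ⟨by simp, fun m hm => ?_⟩
        obtain ⟨j, hj, hjm⟩ := ih.2 b hA
        rcases hop a b with h | h <;> rw [h] at hm
        · exact ⟨i, Finset.mem_insert_self _ _, by rw [hx, hm]⟩
        · exact ⟨j, Finset.mem_insert_of_mem hj, by rw [hjm, hm]⟩

/-- Minimum as a semigroup operation. -/
@[reducible] def minSemigroup (M : Type) [LinearOrder M] : CommSemigroup M where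
  mul a b := min a b
  mul_assoc := min_assoc
  mul_comm := min_comm

theorem minSemigroup_selective [LinearOrder M] (a b : M) :
    (minSemigroup M).mul a b = a ∨ (minSemigroup M).mul a b = b := min_choice a b

end Aggregation

/-! ### Products over trees -/

/-- Layered evaluation of a product over a tree: if the value of a vertex in step `t + 1` is a new
factor times the product of the values of its children in step `t`, then the product of all values
in one layer collects the factors of the layers below it. -/
@[to_additive /-- Layered evaluation of a sum over a tree. -/]
theorem prod_layer {V A : Type} [CommMonoid A] [DecidableEq V] (S : Finset V) (dep : V → ℕ)
    (par : V → V) (ch : V → Finset V)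
    (hch : ∀ v ∈ S, ∀ c, c ∈ ch v ↔ c ∈ S ∧ dep c ≠ 0 ∧ par c = v)
    (hpar : ∀ c ∈ S, dep c ≠ 0 → par c ∈ S ∧ dep (par c) + 1 = dep c)
    (g T : ℕ → V → A) (h0 : ∀ v, T 0 v = g 0 v)
    (hs : ∀ t v, T (t + 1) v = g (t + 1) v * ∏ c ∈ ch v, T t c) (t d : ℕ) :
    ∏ v ∈ S with dep v = d, T t v =
      ∏ v ∈ S with d ≤ dep v ∧ dep v ≤ d + t, g (t + d - dep v) v := by
  induction t generalizing d with
  | zero =>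
    refine Finset.prod_congr (Finset.filter_congr fun v _ => by omega) fun v hv => ?_
    obtain ⟨-, h⟩ := Finset.mem_filter.1 hv
    rw [h0]
    congr 1
    omega
  | succ t ih =>
    have h1 : ∏ v ∈ S with dep v = d, ∏ c ∈ ch v, T t c = ∏ c ∈ S with dep c = d + 1, T t c := by
      rw [← Finset.prod_fiberwise_of_maps_to (s := S.filter fun c => dep c = d + 1)
        (t := S.filter fun v => dep v = d) (g := par)]
      · refine Finset.prod_congr rfl fun v hv => Finset.prod_congr ?_ fun _ _ => rfl
        obtain ⟨hv, hd⟩ := Finset.mem_filter.1 hv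
        ext c
        rw [hch v hv, Finset.mem_filter, Finset.mem_filter]
        constructor
        · rintro ⟨hc, h, rfl⟩
          have := hpar c hc h
          exact ⟨⟨hc, by omega⟩, rfl⟩
        · rintro ⟨⟨hc, h⟩, rfl⟩
          exact ⟨hc, by omega, rfl⟩
      · intro c hc
        obtain ⟨hc, hd⟩ := Finset.mem_filter.1 hc
        have := hpar c hc (by omega)
        exact Finset.mem_filter.2 ⟨this.1, by omega⟩
    simp only [hs]
    rw [Finset.prod_mul_distrib, h1, ih, ← Finset.prod_filter_mul_prod_filter_not
      (s := S.filter fun v => d ≤ dep v ∧ dep v ≤ d + (t + 1)) (p := fun v => dep v = d)]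
    congr 1
    · rw [Finset.filter_filter]
      refine Finset.prod_congr (Finset.filter_congr fun v _ => by omega) fun v hv => ?_
      obtain ⟨-, h⟩ := Finset.mem_filter.1 hv
      congr 1
      omega
    · rw [Finset.filter_filter]
      refine Finset.prod_congr (Finset.filter_congr fun v _ => by omega) fun v hv => ?_
      congr 1
      omega

/-! ### Links that carry one message -/

theorem single_singleton {α : Type} (a : α) : single ({a} : Multiset α) = some a := by
  unfold single
  have h : ∃ b, ({a} : Multiset α) = {b} := ⟨a, rfl⟩
  rw [dif_pos h]
  exact congrArg some (Multiset.singleton_inj.1 h.choose_spec).symm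

theorem single_zero {α : Type} : single (0 : Multiset α) = none := by
  unfold single
  rw [dif_neg]
  rintro ⟨a, h⟩
  exact absurd h.symm (Multiset.singleton_ne_zero a)

/-- Nothing is lost on a link that carries at most one message. -/
theorem single_elim {α : Type} {s : Multiset α} (hs : s.card ≤ 1) :
    (match single s with | none => 0 | some m => {m}) = s := by
  rcases Nat.le_one_iff_eq_zero_or_eq_one.1 hs with h | h
  · rw [Multiset.card_eq_zero.1 h, single_zero]
  · obtain ⟨a, rfl⟩ := Multiset.card_eq_one.1 h
    rw [single_singleton]

namespace Network

variable {V F B : Type} [Fintype V] [Fintype F] [Fintype B] (N : Network V F B)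

theorem leader_injective : Function.Injective N.leader := fun f g h => by
  have := N.leader_mem f
  rw [h, N.leader_mem g] at this
  exact (Option.some_injective _ this).symm

theorem fid_injective : Function.Injective N.fid := N.id_inj.comp N.leader_injective

theorem baseRoot_injective : Function.Injective N.baseRoot := fun b b' h => by
  have := N.base_baseRoot b
  rw [h, N.base_baseRoot b'] at this
  exact (Option.some_injective _ this).symm

theorem frag_of_base {v : V} {b : B} (h : N.base v = some b) : N.frag v = some (N.part b) := by
  simp [frag, h]

theorem frag_eq_some {v : V} {f : F} :
    N.frag v = some f ↔ ∃ b, N.base v = some b ∧ N.part b = f := by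
  simp [frag, Option.map_eq_some_iff]

theorem frag_leader (f : F) : N.frag (N.leader f) = some f := N.leader_mem f

theorem depth_root : N.depth N.root = 0 := SimpleGraph.dist_self

theorem depth_eq_zero {v : V} : N.depth v = 0 ↔ v = N.root := by
  unfold depth
  rw [(N.conn.preconnected N.root v).dist_eq_zero_iff]
  exact eq_comm

theorem depth_up {v : V} (h : v ≠ N.root) : N.depth (N.up v) + 1 = N.depth v := N.up_dist v h

theorem depth_le (v : V) : N.depth v ≤ N.treeDepth := Finset.le_sup (Finset.mem_univ v)

theorem baseDepth_eq_zero {v : V} {b : B} (h : N.base v = some b) :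
    N.baseDepth v = 0 ↔ v = N.baseRoot b := by
  constructor
  · intro h0
    by_contra hne
    have := (N.baseUp_spec v b h hne).2.2
    omega
  · rintro rfl
    exact N.baseDepth_root b

theorem baseDepth_le {v : V} {b : B} (h : N.base v = some b) :
    N.baseDepth v ≤ N.maxBaseDepth := by
  unfold maxBaseDepth
  refine le_trans (le_of_eq ?_) (Finset.le_sup (Finset.mem_univ v))
  simp only [h]

theorem mem_treeChildren {v c : V} : c ∈ N.treeChildren v ↔ c ≠ N.root ∧ N.up c = v := by
  simp [treeChildren]

/-- The layers of the BFS tree. -/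
@[to_additive /-- The layers of the BFS tree. -/]
theorem prod_tree_layer {A : Type} [CommMonoid A] (g T : ℕ → V → A) (h0 : ∀ v, T 0 v = g 0 v)
    (hs : ∀ t v, T (t + 1) v = g (t + 1) v * ∏ c ∈ N.treeChildren v, T t c) (t d : ℕ) :
    ∏ v with N.depth v = d, T t v =
      ∏ v with d ≤ N.depth v ∧ N.depth v ≤ d + t, g (t + d - N.depth v) v := by
  classical
  refine prod_layer Finset.univ N.depth N.up N.treeChildren (fun v _ c => ?_) (fun c _ h => ?_)
    g T h0 hs t d
  · simp [N.mem_treeChildren, N.depth_eq_zero]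
  · exact ⟨Finset.mem_univ _, N.depth_up fun h' => h (N.depth_eq_zero.2 h')⟩

theorem filter_depth_zero : (Finset.univ.filter fun v => N.depth v = 0) = {N.root} := by
  ext v
  simp [N.depth_eq_zero]

open scoped Classical in
/-- The value collected at the root of the BFS tree, if only vertices that have been reached
contribute. -/
@[to_additive /-- The value collected at the root of the BFS tree, if only vertices that have been
reached contribute. -/]
theorem prod_tree_root {A : Type} [CommMonoid A] (g T C : ℕ → V → A) (h0 : ∀ v, T 0 v = g 0 v)
    (hs : ∀ t v, T (t + 1) v = g (t + 1) v * ∏ c ∈ N.treeChildren v, T t c)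
    (hg : ∀ t v, g t v = C (t + N.depth v) v) (hC : ∀ t v, t < N.depth v → C t v = 1) (t : ℕ) :
    T t N.root = ∏ v, C t v := by
  have := N.prod_tree_layer g T h0 hs t 0
  rw [filter_depth_zero, Finset.prod_singleton] at this
  rw [this, Finset.prod_filter]
  refine Finset.prod_congr rfl fun v _ => ?_
  split_ifs with h
  · rw [hg]
    congr 1
    omega
  · exact (hC t v (by omega)).symm

/-! ### Downcast -/

theorem down_eq_some_imp {M : Type} (out : ℕ → Option (M × ℕ)) {t : ℕ} {v : V} {p : M × ℕ}
    (h : N.down out t v = some p) : ∃ s, t = s + N.depth v ∧ out s = some p := by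
  induction t generalizing v p with
  | zero =>
    simp only [down] at h
    split_ifs at h with hv
    exact ⟨0, by rw [hv, N.depth_root], h⟩
  | succ t ih =>
    simp only [down] at h
    split_ifs at h with hv
    · exact ⟨t + 1, by rw [hv, N.depth_root], h⟩
    · cases hd : N.down out t (N.up v) with
      | none => simp [hd] at h
      | some q =>
        obtain ⟨m, l⟩ := q
        simp only [hd] at h
        split_ifs at h
        obtain ⟨s, hs, ho⟩ := ih hd
        refine ⟨s, ?_, by rw [ho, h]⟩
        have := N.depth_up hv
        omega

theorem down_of_ancestor {M : Type} (out : ℕ → Option (M × ℕ)) {s : ℕ} {m : M} {x : V}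
    (ho : out s = some (m, N.id x)) (d : ℕ) :
    ∀ (v : V) (k : ℕ), N.depth v = d → N.up^[k] x = v →
      N.down out (s + d) v = some (m, N.id x) := by
  induction d with
  | zero =>
    intro v k hd _
    have hv := N.depth_eq_zero.1 hd
    cases s <;> simp [down, hv, ho]
  | succ d ih =>
    intro v k hd hk
    have hv : v ≠ N.root := fun h => by rw [h, N.depth_root] at hd; omega
    have := N.depth_up hv
    have := ih (N.up v) (k + 1) (by omega) (by rw [Function.iterate_succ_apply', hk])
    rw [← Nat.add_assoc]
    simp only [down, if_neg hv, this]
    rw [if_pos ⟨x, k, rfl, hk⟩]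

/-- If the root dispatches messages to `v` in at most one round, then `v` gets what is dispatched in
this round. -/
theorem delivered_eq {M : Type} (out : ℕ → Option (M × ℕ)) (v : V) (s : ℕ) (r : Option M)
    (hr : out s = r.map fun m => (m, N.id v)) (hu : ∀ t m, out t = some (m, N.id v) → t = s)
    (hs : s ≤ N.treeDepth + 2 * Fintype.card B) : N.delivered out v = r := by
  have key : ∀ t m, (match N.down out t v with
      | none => none
      | some (m, l) => if l = N.id v then some m else none) = some m → r = some m := by
    intro t m h
    cases hd : N.down out t v with
    | none => simp [hd] at h
    | some q =>
      obtain ⟨m', l⟩ := q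
      simp only [hd] at h
      split_ifs at h with hl
      obtain ⟨s', -, ho⟩ := N.down_eq_some_imp out hd
      subst hl
      obtain rfl := hu s' m' ho
      rw [ho] at hr
      cases r with
      | none => simp at hr
      | some m'' => simp at hr h; rw [← h, hr]
  unfold delivered
  cases h : List.findSome? _ _ with
  | some m =>
    obtain ⟨t, -, ht⟩ := List.exists_of_findSome?_eq_some h
    exact (key t m ht).symm
  | none =>
    rw [List.findSome?_eq_none_iff] at h
    cases r with
    | none => rfl
    | some m =>
      have := h (s + N.depth v) (List.mem_range.2 (by have := N.depth_le v; omega))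
      rw [N.down_of_ancestor out hr (N.depth v) v 0 rfl rfl] at this
      simp at this

/-! ### Convergecast cycles -/

open scoped Classical in
theorem intrinsicUp_baseRoot {M : Type} (op : CommSemigroup M) (x : V → Option M) (b : B) :
    N.intrinsicUp op x N.maxBaseDepth (N.baseRoot b) =
      aggregate op (Finset.univ.filter fun v => N.base v = some b) x := by
  let := optionMonoid op
  have hs : ∀ t v, N.intrinsicUp op x (t + 1) v =
      x v * ∏ c ∈ N.baseChildren v, N.intrinsicUp op x t c := fun _ _ => rfl
  have h := prod_layer (Finset.univ.filter fun v => N.base v = some b) N.baseDepth N.baseUp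
    N.baseChildren (fun v hv c => ?_) (fun c hc h => ?_) (fun _ => x) (N.intrinsicUp op x)
    (fun _ => rfl) hs N.maxBaseDepth 0
  · have h1 : ((Finset.univ.filter fun v => N.base v = some b).filter fun v => N.baseDepth v = 0) =
        {N.baseRoot b} := by
      ext v
      simp only [Finset.mem_filter, Finset.mem_univ, true_and, Finset.mem_singleton]
      constructor
      · rintro ⟨h, h0⟩
        exact (N.baseDepth_eq_zero h).1 h0
      · rintro rfl
        exact ⟨N.base_baseRoot b, N.baseDepth_root b⟩
    rw [h1, Finset.prod_singleton] at h
    rw [h, aggregate_eq_prod]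
    refine Finset.prod_congr (Finset.filter_true_of_mem fun v hv => ?_) fun _ _ => rfl
    have := N.baseDepth_le (Finset.mem_filter.1 hv).2
    omega
  · have hv := (Finset.mem_filter.1 hv).2
    simp only [baseChildren, Finset.mem_filter, Finset.mem_univ, true_and]
    constructor
    · rintro ⟨b', hb, hne, rfl⟩
      have h := (N.baseUp_spec c b' hb hne).2.1
      rw [hv] at h
      obtain rfl := Option.some_injective _ h
      exact ⟨hb, fun h => hne ((N.baseDepth_eq_zero hb).1 h), rfl⟩
    · rintro ⟨hb, hne, rfl⟩
      exact ⟨b, hb, fun h => hne ((N.baseDepth_eq_zero hb).2 h), rfl⟩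
  · have hc := (Finset.mem_filter.1 hc).2
    have := N.baseUp_spec c b hc fun h' => h ((N.baseDepth_eq_zero hc).2 h')
    exact ⟨Finset.mem_filter.2 ⟨Finset.mem_univ _, this.2.1⟩, this.2.2⟩

open scoped Classical in
/-- A product over the vertices in which only distinguished vertices have factors. -/
@[to_additive /-- A sum over the vertices in which only distinguished vertices have summands. -/]
theorem prod_eq_prod_of_injective {W I A : Type} [Fintype W] [Fintype I] [CommMonoid A] {r : I → W}
    (hr : Function.Injective r) (C : W → A) (D : I → A) (h : ∀ i, C (r i) = D i)
    (h1 : ∀ w, (∀ i, w ≠ r i) → C w = 1) : ∏ w, C w = ∏ i, D i := by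
  rw [← Finset.prod_congr rfl fun i _ => h i, ← Finset.prod_image (s := Finset.univ) (f := C)
    fun i _ j _ hij => hr hij]
  refine (Finset.prod_subset (Finset.subset_univ _) fun w _ hw => h1 w fun i hi => hw ?_).symm
  exact Finset.mem_image.2 ⟨i, Finset.mem_univ _, hi.symm⟩

theorem pslot_injective : Function.Injective N.pslot := fun f g h => by
  by_contra hne
  rcases N.slots_disjoint f g hne with h' | h' <;> omega

open scoped Classical in
theorem upcast_root {M : Type} (op : CommSemigroup M) (x : V → Option M) (t : ℕ) :
    N.upcast op x t N.root = aggregate (pairOp op) Finset.univ fun b =>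
      if t = N.pslot (N.part b) + N.treeDepth then
        (aggregate op (Finset.univ.filter fun v => N.base v = some b) x).map
          fun m => (m, N.fid (N.part b))
      else none := by
  let := optionMonoid (pairOp op)
  rw [N.prod_tree_root (fun t v => N.inject op x t v) (N.upcast op x)
    (fun τ v => match N.base v with
      | none => none
      | some b =>
        if v = N.baseRoot b ∧ τ = N.pslot (N.part b) + N.treeDepth then
          (N.intrinsicUp op x N.maxBaseDepth v).map fun m => (m, N.fid (N.part b))
        else none) (fun v => ?_) (fun _ _ => rfl) (fun _ _ => rfl) (fun t v ht => ?_)]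
  · refine prod_eq_prod_of_injective N.baseRoot_injective _ _ (fun b => ?_) fun v hv => ?_
    · simp only [N.base_baseRoot, true_and, N.intrinsicUp_baseRoot]
    · cases hb : N.base v with
      | none => rfl
      | some b => simp only [hv b, false_and, if_false]; rfl
  · unfold upcast inject
    have := N.depth_le v
    cases hb : N.base v with
    | none => rfl
    | some b =>
      have := N.pslot_pos (N.part b)
      simp only
      rw [if_neg (by omega)]
  · have := N.depth_le v
    cases hb : N.base v with
    | none => rfl
    | some b =>
      simp only
      rw [if_neg (by omega)]
      rfl

theorem aggregate_label {M ι : Type} (op : CommSemigroup M) (A : Finset ι) (x : ι → Option M)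
    (l : ℕ) : aggregate (pairOp op) A (fun i => (x i).map fun m => (m, l)) =
      (aggregate op A x).map fun m => (m, l) := by
  refine (aggregate_comp op (pairOp op) (Option.map fun m => (m, l)) rfl (fun a b => ?_) A x).symm
  cases a with
  | none => rw [combine_none_left]; exact (combine_none_left _ _).symm
  | some a =>
    cases b with
    | none => rw [combine_none_right]; exact (combine_none_right _ _).symm
    | some b =>
      have : (pairOp op).mul (a, l) (b, l) = (op.mul a b, l) := Prod.ext rfl (min_self l)
      rw [combine_some_some, Option.map_some, Option.map_some, Option.map_some, combine_some_some,
        this]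

open scoped Classical in
theorem upcast_root_pslot {M : Type} (op : CommSemigroup M) (x : V → Option M) (f : F) :
    N.upcast op x (N.pslot f + N.treeDepth) N.root =
      (aggregate op (Finset.univ.filter fun v => N.frag v = some f) x).map
        fun m => (m, N.fid f) := by
  have h1 : aggregate op (Finset.univ.filter fun v => N.frag v = some f) x =
      aggregate op (Finset.univ.filter fun b => N.part b = f) fun b =>
        aggregate op (Finset.univ.filter fun v => N.base v = some b) x := by
    let := optionMonoid op
    simp only [aggregate_eq_prod]
    rw [← Finset.prod_biUnion]
    · refine Finset.prod_congr ?_ fun _ _ => rfl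
      ext v
      simp [N.frag_eq_some, and_comm]
    · intro b _ b' _ hbb
      refine Finset.disjoint_left.2 fun v hv hv' => hbb ?_
      simp only [Finset.mem_filter] at hv hv'
      exact Option.some_injective _ (hv.2.symm.trans hv'.2)
  rw [upcast_root, h1, ← aggregate_label]
  let := optionMonoid (pairOp op)
  simp only [aggregate_eq_prod]
  rw [Finset.prod_filter]
  refine Finset.prod_congr rfl fun b _ => ?_
  by_cases hb : N.part b = f
  · rw [hb, if_pos rfl, if_pos rfl]
  · rw [if_neg hb, if_neg fun h => hb (N.pslot_injective (by omega)).symm]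
    rfl

open scoped Classical in
theorem upcast_root_eq_some {M : Type} (op : CommSemigroup M) (x : V → Option M) {t : ℕ}
    {p : M × ℕ} (h : N.upcast op x t N.root = some p) :
    ∃ f, t = N.pslot f + N.treeDepth ∧ p.2 = N.fid f := by
  by_cases hf : ∃ f, t = N.pslot f + N.treeDepth
  · obtain ⟨f, rfl⟩ := hf
    rw [upcast_root_pslot, Option.map_eq_some_iff] at h
    obtain ⟨m, -, rfl⟩ := h
    exact ⟨f, rfl, rfl⟩
  · let := optionMonoid (pairOp op)
    rw [upcast_root, aggregate_eq_prod, Finset.prod_eq_one fun b _ => ?_] at h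
    · exact absurd h (Option.some_ne_none p).symm
    · exact if_neg fun h => hf ⟨_, h⟩

open scoped Classical in
/-- A convergecast cycle delivers to each leader the aggregate of the inputs of its fragment. -/
theorem convergecastResult_leader {M : Type} (op : CommSemigroup M) (x : V → Option M) (f : F) :
    N.convergecastResult op x (N.leader f) =
      aggregate op (Finset.univ.filter fun v => N.frag v = some f) x := by
  refine N.delivered_eq _ _ (N.pslot f + N.treeDepth) _ (N.upcast_root_pslot op x f)
    (fun t m h => ?_) ?_
  · obtain ⟨g, ht, hg⟩ := N.upcast_root_eq_some op x h
    rw [ht, N.fid_injective (show N.fid f = N.fid g from hg)]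
  · have := N.pslot_le f
    omega

/-! ### Broadcast cycles -/

open scoped Classical in
/-- What is injected by `v` for the slot whose window reaches the root in round `τ`. -/
noncomputable def slotContent {M : Type} (x : V → M) (τ : ℕ) (v : V) : Multiset (PQ M) :=
  match N.base v with
  | none => 0
  | some b =>
    (if v = N.leader (N.part b) ∧ τ = N.pslot (N.part b) + N.treeDepth then
      {PQ.publish (x v)} else 0) +
    (if v = N.baseRoot b ∧ τ = N.qslot b + N.treeDepth then {PQ.query (N.id v)} else 0)

theorem slotContent_eq_zero {M : Type} (x : V → M) {τ : ℕ} (h : τ ≤ N.treeDepth) (v : V) :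
    N.slotContent x τ v = 0 := by
  unfold slotContent
  cases N.base v with
  | none => rfl
  | some b =>
    have := N.pslot_pos (N.part b)
    have := (N.qslot_mem b).1
    simp only
    rw [if_neg (by omega), if_neg (by omega), add_zero]

open scoped Classical in
theorem sum_slotContent {M : Type} (x : V → M) (τ : ℕ) :
    ∑ v, N.slotContent x τ v =
      ∑ f, (if τ = N.pslot f + N.treeDepth then {PQ.publish (x (N.leader f))} else 0) +
      ∑ b, (if τ = N.qslot b + N.treeDepth then {PQ.query (N.id (N.baseRoot b))} else 0) := by
  have h : ∀ v, N.slotContent x τ v =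
      (match N.base v with
        | none => 0
        | some b => if v = N.leader (N.part b) ∧ τ = N.pslot (N.part b) + N.treeDepth then
            {PQ.publish (x v)} else 0) +
      (match N.base v with
        | none => 0
        | some b => if v = N.baseRoot b ∧ τ = N.qslot b + N.treeDepth then
            {PQ.query (N.id v)} else 0) := by
    intro v
    unfold slotContent
    cases N.base v <;> rfl
  rw [Finset.sum_congr rfl fun v _ => h v, Finset.sum_add_distrib]
  congr 1
  · refine sum_eq_sum_of_injective N.leader_injective _ _ (fun f => ?_) fun v hv => ?_
    · obtain ⟨b, hb, rfl⟩ := N.frag_eq_some.1 (N.frag_leader f)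
      simp only [hb, true_and]
    · cases N.base v with
      | none => rfl
      | some b => simp only [hv, false_and, if_false]
  · refine sum_eq_sum_of_injective N.baseRoot_injective _ _ (fun f => ?_) fun v hv => ?_
    · simp only [N.base_baseRoot, true_and]
    · cases N.base v with
      | none => rfl
      | some b => simp only [hv, false_and, if_false]

theorem qslot_injective : Function.Injective N.qslot := fun b b' h => by
  by_cases hf : N.part b = N.part b'
  · exact N.qslot_inj b b' hf h
  · have h1 := N.qslot_mem b
    have h2 := N.qslot_mem b'
    rcases N.slots_disjoint _ _ hf with h' | h' <;> omega

theorem pslot_ne_qslot (f : F) (b : B) : N.pslot f ≠ N.qslot b := by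
  have h1 := N.qslot_mem b
  by_cases hf : N.part b = f
  · subst hf
    omega
  · rcases N.slots_disjoint _ _ hf with h' | h' <;> omega

theorem sum_slotContent_pslot {M : Type} (x : V → M) (f : F) :
    ∑ v, N.slotContent x (N.pslot f + N.treeDepth) v = {PQ.publish (x (N.leader f))} := by
  classical
  rw [sum_slotContent, Finset.sum_eq_single f, if_pos rfl, Finset.sum_eq_zero, add_zero]
  · intro b _
    rw [if_neg]
    have := N.pslot_ne_qslot f b
    omega
  · intro g _ hg
    rw [if_neg]
    exact fun h => hg (N.pslot_injective (by omega)).symm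
  · simp

theorem sum_slotContent_qslot {M : Type} (x : V → M) (b : B) :
    ∑ v, N.slotContent x (N.qslot b + N.treeDepth) v = {PQ.query (N.id (N.baseRoot b))} := by
  classical
  rw [sum_slotContent, Finset.sum_eq_single (s := Finset.univ) (a := b), if_pos rfl,
    Finset.sum_eq_zero, zero_add]
  · intro f _
    rw [if_neg]
    have := N.pslot_ne_qslot f b
    omega
  · intro g _ hg
    rw [if_neg]
    exact fun h => hg (N.qslot_injective (by omega)).symm
  · simp

theorem sum_slotContent_eq_zero {M : Type} (x : V → M) {τ : ℕ}
    (h1 : ∀ f, τ ≠ N.pslot f + N.treeDepth) (h2 : ∀ b, τ ≠ N.qslot b + N.treeDepth) :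
    ∑ v, N.slotContent x τ v = 0 := by
  classical
  rw [sum_slotContent, Finset.sum_eq_zero fun f _ => if_neg (h1 f),
    Finset.sum_eq_zero fun b _ => if_neg (h2 b), add_zero]

theorem card_sum_slotContent_le {M : Type} (x : V → M) (τ : ℕ) :
    (∑ v, N.slotContent x τ v).card ≤ 1 := by
  by_cases h1 : ∃ f, τ = N.pslot f + N.treeDepth
  · obtain ⟨f, rfl⟩ := h1
    rw [sum_slotContent_pslot, Multiset.card_singleton]
  · by_cases h2 : ∃ b, τ = N.qslot b + N.treeDepth
    · obtain ⟨b, rfl⟩ := h2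
      rw [sum_slotContent_qslot, Multiset.card_singleton]
    · rw [sum_slotContent_eq_zero _ _ (fun f h => h1 ⟨f, h⟩) fun b h => h2 ⟨b, h⟩]
      simp

/-- The upcast of a broadcast cycle, if links could carry several messages. -/
noncomputable def losslessUpcast {M : Type} (x : V → M) : ℕ → V → Multiset (PQ M)
  | 0, _ => 0
  | t + 1, v => N.injectPQ x (t + 1) v + ∑ c ∈ N.treeChildren v, losslessUpcast x t c

theorem injectPQ_eq {M : Type} (x : V → M) (t : ℕ) (v : V) :
    N.injectPQ x t v = N.slotContent x (t + N.depth v) v := rfl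

theorem losslessUpcast_zero {M : Type} (x : V → M) (v : V) :
    N.losslessUpcast x 0 v = N.injectPQ x 0 v := by
  rw [injectPQ_eq, slotContent_eq_zero]
  · rfl
  · have := N.depth_le v
    omega

theorem losslessUpcast_root {M : Type} (x : V → M) (t : ℕ) :
    N.losslessUpcast x t N.root = ∑ v, N.slotContent x t v :=
  N.sum_tree_root (N.injectPQ x) (N.losslessUpcast x) (N.slotContent x)
    (N.losslessUpcast_zero x) (fun _ _ => rfl) (N.injectPQ_eq x)
    (fun _ v ht => N.slotContent_eq_zero x (ht.le.trans (N.depth_le v)) v) t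

theorem card_losslessUpcast_le {M : Type} (x : V → M) (t : ℕ) (v : V) :
    (N.losslessUpcast x t v).card ≤ 1 := by
  classical
  refine le_trans (Multiset.card_le_card ?_) (N.card_sum_slotContent_le x (t + N.depth v))
  have h := N.sum_tree_layer (N.injectPQ x) (N.losslessUpcast x) (N.losslessUpcast_zero x)
    (fun _ _ => rfl) t (N.depth v)
  calc N.losslessUpcast x t v
      ≤ ∑ u with N.depth u = N.depth v, N.losslessUpcast x t u :=
        Finset.single_le_sum (f := fun u => N.losslessUpcast x t u) (fun _ _ => Multiset.zero_le _)
          (Finset.mem_filter.2 ⟨Finset.mem_univ v, rfl⟩)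
    _ = _ := h
    _ ≤ ∑ u with N.depth v ≤ N.depth u ∧ N.depth u ≤ N.depth v + t,
          N.slotContent x (t + N.depth v) u := by
        refine Finset.sum_le_sum fun u hu => le_of_eq ?_
        obtain ⟨-, hu⟩ := Finset.mem_filter.1 hu
        rw [injectPQ_eq]
        congr 1
        omega
    _ ≤ ∑ u, N.slotContent x (t + N.depth v) u :=
        Finset.sum_le_sum_of_subset_of_nonneg (Finset.filter_subset _ _)
          fun _ _ _ => Multiset.zero_le _

theorem upcastPQ_eq {M : Type} (x : V → M) (t : ℕ) (v : V) :
    N.upcastPQ x t v = single (N.losslessUpcast x t v) := by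
  induction t generalizing v with
  | zero => exact single_zero.symm
  | succ t ih =>
    simp only [upcastPQ, losslessUpcast]
    congr 2
    refine Finset.sum_congr rfl fun c _ => ?_
    rw [ih]
    have h := single_elim (N.card_losslessUpcast_le x t c)
    cases hs : single (N.losslessUpcast x t c) <;> rw [hs] at h <;> exact h

theorem upcastPQ_pslot {M : Type} (x : V → M) (f : F) :
    N.upcastPQ x (N.pslot f + N.treeDepth) N.root = some (PQ.publish (x (N.leader f))) := by
  rw [upcastPQ_eq, losslessUpcast_root, sum_slotContent_pslot, single_singleton]

theorem upcastPQ_qslot {M : Type} (x : V → M) (b : B) :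
    N.upcastPQ x (N.qslot b + N.treeDepth) N.root = some (PQ.query (N.id (N.baseRoot b))) := by
  rw [upcastPQ_eq, losslessUpcast_root, sum_slotContent_qslot, single_singleton]

theorem upcastPQ_eq_none {M : Type} (x : V → M) {τ : ℕ}
    (h1 : ∀ f, τ ≠ N.pslot f + N.treeDepth) (h2 : ∀ b, τ ≠ N.qslot b + N.treeDepth) :
    N.upcastPQ x τ N.root = none := by
  rw [upcastPQ_eq, losslessUpcast_root, sum_slotContent_eq_zero _ _ h1 h2, single_zero]

theorem upcastPQ_publish {M : Type} (x : V → M) {τ : ℕ} {m : M}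
    (h : N.upcastPQ x τ N.root = some (PQ.publish m)) : ∃ f, τ = N.pslot f + N.treeDepth := by
  by_contra hf
  push Not at hf
  by_cases h2 : ∃ b, τ = N.qslot b + N.treeDepth
  · obtain ⟨b, rfl⟩ := h2
    rw [upcastPQ_qslot] at h
    cases h
  · rw [upcastPQ_eq_none _ _ hf fun b h => h2 ⟨b, h⟩] at h
    cases h

theorem upcastPQ_query {M : Type} (x : V → M) {τ : ℕ} {l : ℕ}
    (h : N.upcastPQ x τ N.root = some (PQ.query l)) :
    ∃ b, τ = N.qslot b + N.treeDepth ∧ l = N.id (N.baseRoot b) := by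
  by_cases h2 : ∃ b, τ = N.qslot b + N.treeDepth
  · obtain ⟨b, rfl⟩ := h2
    rw [upcastPQ_qslot] at h
    cases h
    exact ⟨b, rfl, rfl⟩
  · by_cases h1 : ∃ f, τ = N.pslot f + N.treeDepth
    · obtain ⟨f, rfl⟩ := h1
      rw [upcastPQ_pslot] at h
      cases h
    · rw [upcastPQ_eq_none _ _ (fun f h => h1 ⟨f, h⟩) fun b h => h2 ⟨b, h⟩] at h
      cases h

/-- In the slots of a fragment, the root of the BFS tree stores the message of its leader. -/
theorem stored_eq {M : Type} (x : V → M) (f : F) (j : ℕ)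
    (hj : j ≤ Nat.card {b : B // N.part b = f}) :
    N.stored x (N.pslot f + N.treeDepth + j) = some (x (N.leader f)) := by
  induction j with
  | zero =>
    obtain ⟨p, hp⟩ : ∃ p, N.pslot f + N.treeDepth = p + 1 :=
      ⟨N.pslot f + N.treeDepth - 1, by have := N.pslot_pos f; omega⟩
    rw [Nat.add_zero, hp, stored, ← hp, upcastPQ_pslot]
  | succ j ih =>
    rw [← Nat.add_assoc, stored]
    split
    · next m h =>
      obtain ⟨g, hg⟩ := N.upcastPQ_publish x h
      exfalso
      by_cases hfg : f = g
      · subst hfg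
        omega
      · rcases N.slots_disjoint f g hfg with h' | h' <;> omega
    · exact ih (by omega)

theorem response_qslot {M : Type} (x : V → M) (b : B) :
    N.response x (N.qslot b + N.treeDepth) =
      some (x (N.leader (N.part b)), N.id (N.baseRoot b)) := by
  have h := N.qslot_mem b
  have hs := N.stored_eq x (N.part b) (N.qslot b - N.pslot (N.part b)) (by omega)
  have he : N.pslot (N.part b) + N.treeDepth + (N.qslot b - N.pslot (N.part b)) =
      N.qslot b + N.treeDepth := by omega
  rw [he] at hs
  simp only [response, upcastPQ_qslot, hs, Option.map_some]

theorem delivered_response {M : Type} (x : V → M) (b : B) :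
    N.delivered (N.response x) (N.baseRoot b) = some (x (N.leader (N.part b))) := by
  refine N.delivered_eq _ _ (N.qslot b + N.treeDepth) _ (N.response_qslot x b)
    (fun t m h => ?_) ?_
  · unfold response at h
    split at h
    · next l hl =>
      obtain ⟨b', rfl, rfl⟩ := N.upcastPQ_query x hl
      rw [Option.map_eq_some_iff] at h
      obtain ⟨m', -, h⟩ := h
      rw [N.baseRoot_injective (N.id_inj (congrArg Prod.snd h))]
    · cases h
  · have := N.pslot_le (N.part b)
    have := N.qslot_mem b
    omega

theorem intrinsicDown_eq {M : Type} (y : V → Option M) (k : ℕ) {v : V} {b : B}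
    (h : N.base v = some b) (hk : N.baseDepth v ≤ k) :
    N.intrinsicDown y k v = y (N.baseRoot b) := by
  classical
  have hroot : ∀ {v}, N.base v = some b → (∃ b', v = N.baseRoot b') → v = N.baseRoot b := by
    rintro v h ⟨b', rfl⟩
    rw [N.base_baseRoot] at h
    rw [Option.some_injective _ h]
  induction k generalizing v with
  | zero =>
    have hv := (N.baseDepth_eq_zero h).1 (by omega)
    rw [intrinsicDown, if_pos ⟨b, hv⟩, hv]
  | succ k ih =>
    rw [intrinsicDown]
    split_ifs with hr
    · rw [hroot h hr]
    · have := N.baseUp_spec v b h fun h' => hr ⟨b, h'⟩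
      rw [h]
      exact ih this.2.1 (by omega)

/-- In a broadcast cycle, every vertex of a fragment gets the message of the leader. -/
theorem broadcastResult_eq {M : Type} (x : V → M) {v : V} {f : F} (h : N.frag v = some f) :
    N.broadcastResult x v = some (x (N.leader f)) := by
  obtain ⟨b, hb, rfl⟩ := N.frag_eq_some.1 h
  rw [broadcastResult, N.intrinsicDown_eq _ _ hb (N.baseDepth_le hb), delivered_response]

end Network

/-! ### MWOEs and the virtual forest -/

namespace Network

variable {V F B : Type} [Fintype V] [Fintype F] [Fintype B] (N : Network V F B)

/-- The fragment `g` has a parent, and its MWOE leads from `u` to `v`. -/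
def Link (g : F) (u v : V) : Prop := N.mwoe g = some (u, v) ∧ (N.parent g).isSome

variable {N}

theorem frag_mwoe {g : F} {u v : V} (h : N.mwoe g = some (u, v)) : N.frag u = some g :=
  (N.mwoe_some g u v h).2.1

theorem adj_mwoe {g : F} {u v : V} (h : N.mwoe g = some (u, v)) : N.G.Adj u v :=
  N.H_le (N.mwoe_some g u v h).1

theorem ownPort_iff {g : F} {u v : V} (hu : N.frag u = some g) :
    N.OwnPort u v ↔ N.mwoe g = some (u, v) := by
  constructor
  · rintro ⟨f, hf, h⟩
    rw [hu] at hf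
    rwa [Option.some_injective _ hf]
  · exact fun h => ⟨g, hu, h⟩

theorem exists_frag_mwoe {g : F} {u v : V} (h : N.mwoe g = some (u, v)) :
    ∃ f, N.frag v = some f ∧ f ≠ g := by
  obtain ⟨hH, hu, hv, -⟩ := N.mwoe_some g u v h
  have h1 := N.base_closed u v hH
  cases hb : N.base v with
  | none =>
    rw [h1.2 hb] at hu
    cases hu
  | some b =>
    refine ⟨N.part b, N.frag_of_base hb, fun h => hv ?_⟩
    rw [hb, Option.map_some, h]

/-- The MWOE of a fragment with a parent leads to the parent. -/
theorem frag_of_parent {f g : F} (h : N.parent g = some f) :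
    ∃ u v, N.mwoe g = some (u, v) ∧ N.frag v = some f := by
  unfold parent at h
  split at h
  · cases h
  · next a b hm =>
    split at h
    · cases h
    · next f' hf =>
      split_ifs at h
      exact ⟨a, b, hm, by rw [hf, h]⟩

theorem parent_eq_of_link {g : F} {u v : V} (h : N.Link g u v) : N.parent g = N.frag v := by
  obtain ⟨h, hp⟩ := h
  obtain ⟨f, hf⟩ := Option.isSome_iff_exists.1 hp
  obtain ⟨u', v', h', hv⟩ := frag_of_parent hf
  rw [h] at h'
  cases h'
  rw [hf, hv]

theorem parent_ne_self {f g : F} (h : N.parent g = some f) : f ≠ g := by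
  obtain ⟨u, v, hm, hv⟩ := frag_of_parent h
  obtain ⟨f', hf', hne⟩ := exists_frag_mwoe hm
  rw [hv] at hf'
  rwa [Option.some_injective _ hf']

/-- A fragment with an MWOE that has no parent is the parent of the fragment at the other end. -/
theorem exists_child_of_root {f : F} (hp : N.parent f = none) (hm : N.mwoe f ≠ none) :
    ∃ g, N.parent g = some f := by
  obtain ⟨⟨a, b⟩, hab⟩ := Option.ne_none_iff_exists'.1 hm
  obtain ⟨g, hg, hne⟩ := exists_frag_mwoe hab
  unfold parent at hp
  simp only [hab, hg] at hp
  split_ifs at hp with h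
  refine ⟨g, ?_⟩
  unfold parent
  simp only [h.1, frag_mwoe hab]
  rw [if_neg fun h' => absurd h'.2 (lt_asymm h.2)]

theorem link_frag {g : F} {u v : V} (h : N.Link g u v) : N.frag u = some g := frag_mwoe h.1

theorem exists_link {f g : F} (h : N.parent g = some f) :
    ∃ u v, N.Link g u v ∧ N.frag v = some f := by
  obtain ⟨u, v, hm, hv⟩ := frag_of_parent h
  exact ⟨u, v, ⟨hm, by rw [h]; rfl⟩, hv⟩

theorem mem_children {f g : F} : g ∈ N.children f ↔ N.parent g = some f := by
  simp [children]

end Network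

/-! ### Execution of single steps -/

namespace CStep

variable {V F B : Type} [Fintype V] [Fintype F] [Fintype B] {N : Network V F B} {σ M : Type}

open Network

open scoped Classical in
theorem exec_convergecast_st (op : CommSemigroup M) (own : σ → Option M)
    (port : σ → Prop → M → Option M) (upd : σ → Option M → σ) (c : Conf V σ M) (v : V) (f : F)
    (hv : N.frag v = some f) :
    (exec N c (convergecast op own port upd)).st v =
      if v = N.leader f then
        upd (c.st v) (aggregate op (Finset.univ.filter fun u => N.frag u = some f)
          (input N op own port c))
      else c.st v := by
  simp only [exec]
  by_cases h : v = N.leader f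
  · rw [if_pos ⟨f, h⟩, if_pos h, h, N.convergecastResult_leader]
  · rw [if_neg h, if_neg]
    rintro ⟨g, rfl⟩
    rw [N.frag_leader] at hv
    exact h (by rw [Option.some_injective _ hv])

theorem exec_broadcast_st (msg : σ → M) (upd : σ → M → σ) (c : Conf V σ M) {v : V} {f : F}
    (hv : N.frag v = some f) :
    (exec N c (broadcast msg upd)).st v = upd (c.st v) (msg (c.st (N.leader f))) := by
  simp only [exec, N.broadcastResult_eq _ hv]

theorem exec_round_buf (send : σ → Prop → Option M → Option M) (c : Conf V σ M) (u v : V) :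
    (exec N c (round send)).buf v u = sent N send c u v := rfl

open scoped Classical in
theorem input_none (op : CommSemigroup M) (port : σ → Prop → M → Option M) (c : Conf V σ M)
    (v : V) :
    input N op (fun _ => none) port c v = aggregate op (Finset.univ.filter fun u => N.G.Adj v u)
      fun u => (c.buf v u).bind (port (c.st v) (N.OwnPort v u)) :=
  combine_none_left _ _

open scoped Classical in
/-- Convergecast of what has been received over the own MWOE. -/
theorem aggregate_own_port (op : CommSemigroup M) (c : Conf V σ M) (g : F) (r : Option M)
    (h : ∀ u v, N.mwoe g = some (u, v) → c.buf u v = r) (h0 : N.mwoe g = none → r = none) :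
    aggregate op (Finset.univ.filter fun u => N.frag u = some g)
      (input N op (fun _ => none) (fun _ own m => if own then some m else none) c) = r := by
  let := optionMonoid op
  simp only [aggregate_eq_prod, input_none]
  have hz : ∀ u v, N.frag u = some g → N.mwoe g ≠ some (u, v) →
      ((c.buf u v).bind fun m => if N.OwnPort u v then some m else none) = none := by
    intro u v hu hm
    rw [Option.bind_eq_none_iff]
    exact fun m _ => if_neg fun h => hm ((ownPort_iff hu).1 h)
  cases hm : N.mwoe g with
  | none =>
    rw [h0 hm]
    refine Finset.prod_eq_one fun u hu => Finset.prod_eq_one fun v _ => ?_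
    exact hz u v (Finset.mem_filter.1 hu).2 (by rw [hm]; simp)
  | some e =>
    obtain ⟨a, b⟩ := e
    have ha := frag_mwoe hm
    rw [Finset.prod_eq_single a, Finset.prod_eq_single b]
    · rw [h a b hm]
      have : N.OwnPort a b := (ownPort_iff ha).2 hm
      simp only [this, if_true]
      cases r <;> rfl
    · intro v _ hv
      refine hz a v ha fun h' => hv ?_
      rw [hm] at h'
      cases h'
      rfl
    · intro h'
      exact absurd (Finset.mem_filter.2 ⟨Finset.mem_univ _, adj_mwoe hm⟩) h'
    · intro u hu hne
      refine Finset.prod_eq_one fun v _ => ?_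
      refine hz u v (Finset.mem_filter.1 hu).2 fun h' => hne ?_
      rw [hm] at h'
      cases h'
      rfl
    · intro h'
      exact absurd (Finset.mem_filter.2 ⟨Finset.mem_univ a, ha⟩) h'

open scoped Classical in
/-- Convergecast of what the children have sent over their MWOEs. -/
theorem aggregate_children (op : CommSemigroup M) (c : Conf V σ M) (f : F) (r : F → M)
    (h : ∀ g u v, N.Link g u v → c.buf v u = some (r g))
    (h0 : ∀ u v, (∀ g, ¬ N.Link g u v) → c.buf v u = none) :
    aggregate op (Finset.univ.filter fun v => N.frag v = some f)
      (input N op (fun _ => none) (fun _ _ m => some m) c) =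
        aggregate op (N.children f) fun g => some (r g) := by
  let := optionMonoid op
  simp only [aggregate_eq_prod, input_none]
  have hb : ∀ o : Option M, (o.bind fun m => some m) = o := fun o => by cases o <;> rfl
  simp only [hb]
  rw [Finset.prod_sigma']
  have : Nonempty V := N.conn.nonempty
  choose! s t hst using fun g (hg : N.parent g = some f) => exists_link hg
  symm
  refine Finset.prod_of_injOn (fun g => (⟨t g, s g⟩ : (_ : V) × V)) ?_ ?_ ?_ ?_
  · intro g hg g' hg' hgg
    have h1 := link_frag (hst g (mem_children.1 hg)).1
    have h2 := link_frag (hst g' (mem_children.1 hg')).1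
    simp only [Sigma.mk.injEq, heq_eq_eq] at hgg
    rw [hgg.2, h2] at h1
    exact (Option.some_injective _ h1).symm
  · intro g hg
    have hg := hst g (mem_children.1 hg)
    simp only [Finset.coe_sigma, Set.mem_sigma_iff, Finset.mem_coe, Finset.mem_filter,
      Finset.mem_univ, true_and]
    exact ⟨hg.2, (adj_mwoe hg.1.1).symm⟩
  · rintro ⟨v, u⟩ hvu hne
    refine h0 u v fun g hg => hne ?_
    have hv : N.frag v = some f := (Finset.mem_filter.1 (Finset.mem_sigma.1 hvu).1).2
    have hp : N.parent g = some f := by rw [parent_eq_of_link hg, hv]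
    refine ⟨g, mem_children.2 hp, ?_⟩
    have := (hst g hp).1.1
    rw [hg.1] at this
    cases this
    rfl
  · intro g hg
    exact (h g _ _ (hst g (mem_children.1 hg)).1).symm

end CStep

/-! ### The simulating algorithm -/

/-- Messages of the simulating algorithm: a message of the virtual round, or an identity. -/
abbrev SimMsg (M : Type) (k : ℕ) : Type := Option M × Fin (2 ^ k)

/-- States of the simulating algorithm. -/
structure SimState (σ M : Type) (k : ℕ) where
  /-- the state of the fragment -/
  val : σ
  /-- does the fragment have a parent? -/
  hasParent : Bool
  /-- the identity of the fragment -/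
  fid : Fin (2 ^ k)
  /-- the last message of a convergecast or broadcast cycle -/
  scratch : Option (SimMsg M k)

namespace SimState

variable {σ M : Type} {k : ℕ}

/-- The components of a state. -/
def toProd (s : SimState σ M k) : σ × Bool × Fin (2 ^ k) × Option (SimMsg M k) :=
  (s.val, s.hasParent, s.fid, s.scratch)

theorem toProd_injective : Function.Injective (toProd : SimState σ M k → _) := by
  rintro ⟨⟩ ⟨⟩ h
  simp only [toProd, Prod.mk.injEq] at h
  simp [h]

noncomputable instance [Fintype σ] [Fintype M] : Fintype (SimState σ M k) :=
  Fintype.ofInjective toProd toProd_injective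

/-- The encoding of the state `x` of a fragment at a vertex with the initial knowledge `i`. -/
def enc (k : ℕ) (i : Info) (x : σ) : SimState σ M k :=
  ⟨x, i.parentFid.isSome, Fin.ofNat _ i.fid, none⟩

/-- Replace the scratch register. -/
def store (s : SimState σ M k) (r : Option (SimMsg M k)) : SimState σ M k := { s with scratch := r }

/-- The content of the scratch register as a message. -/
def load (s : SimState σ M k) : SimMsg M k := s.scratch.getD (none, 0)

/-- Update the state of the fragment and clear the scratch register. -/
def finish (upd : σ → Option M → σ) (s : SimState σ M k) (m : SimMsg M k) : SimState σ M k :=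
  { s with val := upd s.val m.1, scratch := none }

theorem card_simMsg_le [Fintype M] {a L : ℕ} (hL : 1 ≤ L) (hM : Fintype.card M ≤ 2 ^ (a * L)) :
    Fintype.card (SimMsg M (a * L)) ≤ 2 ^ ((2 * a + 1) * L) := by
  rw [Fintype.card_prod, Fintype.card_option, Fintype.card_fin]
  have h1 : 1 ≤ 2 ^ (a * L) := Nat.one_le_two_pow
  have h2 : 2 ≤ 2 ^ L := Nat.le_self_pow (by omega) 2
  calc (Fintype.card M + 1) * 2 ^ (a * L) ≤ (2 ^ (a * L) * 2 ^ L) * 2 ^ (a * L) := by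
        gcongr
        nlinarith
    _ = _ := by rw [← pow_add, ← pow_add]; congr 1; ring

theorem card_le [Fintype σ] [Fintype M] {a L : ℕ} (hL : 1 ≤ L)
    (hM : Fintype.card M ≤ 2 ^ (a * L)) :
    Fintype.card (SimState σ M (a * L)) ≤ Fintype.card σ * 2 ^ ((3 * a + 3) * L) := by
  refine (Fintype.card_le_of_injective _ toProd_injective).trans ?_
  simp only [Fintype.card_prod σ, Fintype.card_prod Bool, Fintype.card_prod (Fin _),
    Fintype.card_bool, Fintype.card_fin,
    Fintype.card_option (α := SimMsg M (a * L))]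
  have h0 := card_simMsg_le hL hM
  have h1 : 1 ≤ 2 ^ ((2 * a + 1) * L) := Nat.one_le_two_pow
  have h2 : 2 ≤ 2 ^ L := Nat.le_self_pow (by omega) 2
  calc Fintype.card σ * (2 * (2 ^ (a * L) * (Fintype.card (SimMsg M (a * L)) + 1)))
      ≤ Fintype.card σ * (2 ^ L * (2 ^ (a * L) * (2 ^ ((2 * a + 1) * L) * 2 ^ L))) := by
        gcongr
        nlinarith
    _ = _ := by rw [← pow_add, ← pow_add, ← pow_add]; congr 2; ring

end SimState

open SimState

/-- Minimum with respect to an arbitrary enumeration. -/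
@[reducible] noncomputable def anySemigroup (M : Type) [Fintype M] : CommSemigroup M :=
  letI := LinearOrder.lift' (Fintype.equivFin M) (Fintype.equivFin M).injective
  minSemigroup M

theorem anySemigroup_selective {M : Type} [Fintype M] (a b : M) :
    (anySemigroup M).mul a b = a ∨ (anySemigroup M).mul a b = b :=
  letI := LinearOrder.lift' (Fintype.equivFin M) (Fintype.equivFin M).injective
  min_choice a b

/-- Aggregate the messages of a virtual round. -/
@[reducible] noncomputable def simOp {M : Type} (op : CommSemigroup M) (k : ℕ) :
    CommSemigroup (SimMsg M k) where
  mul x y := (combine op x.1 y.1, min x.2 y.2)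
  mul_assoc x y z := Prod.ext ((optionMonoid op).mul_assoc x.1 y.1 z.1) (min_assoc _ _ _)
  mul_comm x y := Prod.ext ((optionMonoid op).mul_comm x.1 y.1) (min_comm _ _)

theorem aggregate_simOp {M ι : Type} (op : CommSemigroup M) (k : ℕ) (A : Finset ι) (x : ι → M) :
    ((aggregate (simOp op k) A fun i => some (some (x i), 0)).getD (none, 0)).1 =
      aggregate op A fun i => some (x i) := by
  refine aggregate_comp (simOp op k) op (fun o => (o.getD (none, 0)).1) rfl (fun a b => ?_) A _
  cases a with
  | none => simp only [combine_none_left, Option.getD_none]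
  | some a =>
    cases b with
    | none => simp only [combine_none_right, Option.getD_none]
    | some b => rfl

namespace VStep

variable {σ M : Type} {k : ℕ}

open scoped Classical in
/-- Fragments that have parents send messages over their MWOEs. -/
noncomputable def announce (msg : σ → Fin (2 ^ k) → SimMsg M k) :
    CStep (SimState σ M k) (SimMsg M k) :=
  .round fun s own _ => if own ∧ s.hasParent then some (msg s.val s.fid) else none

open scoped Classical in
/-- The leader gets what has been received over the own MWOE. -/
noncomputable def collectOwn [Fintype M] : CStep (SimState σ M k) (SimMsg M k) :=
  .convergecast (anySemigroup _) (fun _ => none) (fun _ own m => if own then some m else none) store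

/-- The leader gets the aggregate of everything that has been received. -/
def collectAll (op : CommSemigroup (SimMsg M k)) : CStep (SimState σ M k) (SimMsg M k) :=
  .convergecast op (fun _ => none) (fun _ _ m => some m) store

/-- The leader distributes the received message, and the state of the fragment is updated. -/
def conclude (upd : σ → Option M → σ) : CStep (SimState σ M k) (SimMsg M k) :=
  .broadcast load (finish upd)

open scoped Classical in
/-- The steps that simulate a virtual round. -/
noncomputable def simulate [Fintype M] (k : ℕ) :
    VStep σ M → List (CStep (SimState σ M k) (SimMsg M k))
  | toChildren msg upd =>
    [announce fun _ i => (none, i),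
      .round fun s _ b => b.map fun _ => (some (msg s.val), 0),
      collectOwn, conclude upd]
  | toOneChild msg upd =>
    [announce fun _ i => (none, i),
      collectAll (anySemigroup _), .broadcast load fun s m => s.store (some m),
      .round fun s _ b => if b ≠ none ∧ b = s.scratch then some (some (msg s.val), 0) else none,
      collectOwn, conclude upd]
  | toParent op msg upd =>
    [announce fun s _ => (some (msg s), 0), collectAll (simOp op k), conclude upd]

end VStep

namespace Network

variable {V F B : Type} [Fintype V] [Fintype F] [Fintype B] {N : Network V F B}
  {σ M : Type} {k : ℕ}

/-- The identity of a fragment as a number of `k` bits. -/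
def shortFid (N : Network V F B) (k : ℕ) (f : F) : Fin (2 ^ k) := Fin.ofNat _ (N.fid f)

theorem shortFid_val (hid : ∀ v, N.id v < 2 ^ k) (f : F) : (N.shortFid k f).val = N.fid f :=
  Nat.mod_eq_of_lt (hid _)

theorem shortFid_injective (hid : ∀ v, N.id v < 2 ^ k) : Function.Injective (N.shortFid k) :=
  fun f g h => N.fid_injective (by rw [← shortFid_val hid, h, shortFid_val hid])

/-- The state of a vertex of the fragment `f`, with scratch register `r`. -/
noncomputable def simState (N : Network V F B) (s : F → σ) (f : F) (r : Option (SimMsg M k)) :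
    SimState σ M k :=
  ⟨s f, (N.parent f).isSome, N.shortFid k f, r⟩

theorem enc_info (s : F → σ) (v : V) (f : F) :
    enc k (N.info v f) (s f) = N.simState (M := M) s f none := by
  simp only [enc, info, simState, Option.isSome_map, shortFid]

theorem holdsCopies_iff (s : F → σ) (c : Conf V (SimState σ M k) (SimMsg M k)) :
    HoldsCopies N (enc k) s c ↔ ∀ v f, N.frag v = some f → c.st v = N.simState s f none := by
  simp only [HoldsCopies, enc_info]

end Network

namespace VStep

open Network CStep

variable {V F B : Type} [Fintype V] [Fintype F] [Fintype B] {N : Network V F B}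
  {σ M : Type} {k : ℕ} {s : F → σ} {c : Conf V (SimState σ M k) (SimMsg M k)}

theorem announce_sent (msg : σ → Fin (2 ^ k) → SimMsg M k)
    (hc : HoldsCopies N (enc k) s c) :
    (∀ g u v, N.Link g u v → (exec N c (announce msg)).buf v u =
        some (msg (s g) (N.shortFid k g))) ∧
      ∀ u v, (∀ g, ¬ N.Link g u v) → (exec N c (announce msg)).buf v u = none := by
  rw [holdsCopies_iff] at hc
  simp only [announce, exec, sent]
  constructor
  · intro g u v h
    have hu := link_frag h
    rw [if_pos ⟨by rw [hu]; simp, adj_mwoe h.1⟩, hc u g hu,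
      if_pos ⟨(ownPort_iff hu).2 h.1, h.2⟩]
    rfl
  · intro u v h
    split_ifs with h1 h2
    · exfalso
      obtain ⟨g, hu⟩ := Option.ne_none_iff_exists'.1 h1.1
      rw [hc u g hu] at h2
      exact h g ⟨(ownPort_iff hu).1 h2.1, h2.2⟩
    · rfl
    · rfl

theorem announce_legal (msg : σ → Fin (2 ^ k) → SimMsg M k) : Legal N c (announce msg) := by
  intro u v h
  simp only [sent] at h
  split_ifs at h with h1 h2
  · exact Or.inl h2.1
  · exact absurd rfl h
  · exact absurd rfl h

/-- Replies to announcements are sent over MWOEs. -/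
theorem reply_legal (send : SimState σ M k → Prop → Option (SimMsg M k) → Option (SimMsg M k))
    (hs : ∀ s p, send s p none = none)
    (h0 : ∀ u v, (∀ g, ¬ N.Link g u v) → c.buf v u = none) : Legal N c (.round send) := by
  intro u v h
  simp only [sent] at h
  split_ifs at h with h1
  · right
    by_contra hv
    refine h ?_
    rw [h0 v u fun g hg => hv ⟨g, link_frag hg, hg.1⟩, hs]
  · exact absurd rfl h

open scoped Classical in
theorem exec_collect_conclude (upd : σ → Option M → σ) (op : CommSemigroup (SimMsg M k))
    (port : SimState σ M k → Prop → SimMsg M k → Option (SimMsg M k)) (t : F → Option (SimMsg M k))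
    (hc : ∀ v f, N.frag v = some f → c.st v = N.simState s f (t f)) (s' : F → σ)
    (h : ∀ f, s' f = upd (s f) ((aggregate op (Finset.univ.filter fun v => N.frag v = some f)
      (input N op (fun _ => none) port c)).getD (none, 0)).1) :
    HoldsCopies N (enc k) s'
      (execAll N c [.convergecast op (fun _ => none) port store, conclude upd]) := by
  rw [holdsCopies_iff]
  intro v f hv
  simp only [execAll, conclude]
  rw [exec_broadcast_st _ _ _ hv, exec_convergecast_st _ _ _ _ _ _ _ hv,
    exec_convergecast_st _ _ _ _ _ _ _ (N.frag_leader f), if_pos rfl]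
  have h1 : ∀ m, finish upd (c.st v) m = finish upd (N.simState s f (t f)) m := by
    intro m
    rw [hc v f hv]
  have h2 : ∀ r m, finish upd (store (c.st v) r) m = finish upd (N.simState s f (t f)) m := by
    intro r m
    rw [hc v f hv]
    rfl
  split_ifs
  · rw [h2]
    simp only [finish, load, store, simState, h f]
  · rw [h1]
    simp only [finish, load, store, simState, h f]

open scoped Classical in
/-- Every child receives what has been sent to it over its MWOE. -/
theorem exec_collectOwn_conclude [Fintype M] (upd : σ → Option M → σ) (t : F → Option (SimMsg M k))
    (hc : ∀ v f, N.frag v = some f → c.st v = N.simState s f (t f)) (s' : F → σ)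
    (r : F → Option M)
    (hr : ∀ g u v, N.mwoe g = some (u, v) → c.buf u v = (r g).map fun m => (some m, 0))
    (hr0 : ∀ g, N.mwoe g = none → r g = none)
    (h : ∀ f, s' f = upd (s f) (r f)) :
    HoldsCopies N (enc k) s' (execAll N c [collectOwn, conclude upd]) := by
  refine exec_collect_conclude upd _ _ t hc s' fun f => ?_
  rw [aggregate_own_port _ c f ((r f).map fun m => (some m, 0)) (hr f)
    (fun hm => by rw [hr0 f hm]; rfl), h f]
  cases r f <;> rfl

theorem simulate_toParent [Fintype M] (op : CommSemigroup M) (msg : σ → M) (upd : σ → Option M → σ)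
    (hc : HoldsCopies N (enc k) s c) :
    LegalAll N c (simulate k (toParent op msg upd)) ∧
      ∃ s', (toParent op msg upd).Result N s s' ∧
        HoldsCopies N (enc k) s' (execAll N c (simulate k (toParent op msg upd))) := by
  classical
  refine ⟨⟨announce_legal _, trivial, trivial, trivial⟩, _, fun _ => rfl, ?_⟩
  obtain ⟨h1, h0⟩ := announce_sent (fun x _ => (some (msg x), 0)) hc
  refine exec_collect_conclude (c := exec N c _) upd _ _ (fun _ => none)
    ((holdsCopies_iff s c).1 hc) _ fun f => ?_
  rw [aggregate_children _ _ f (fun g => (some (msg (s g)), 0)) h1 h0, aggregate_simOp]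

theorem simulate_toChildren [Fintype M] (msg : σ → M) (upd : σ → Option M → σ)
    (hc : HoldsCopies N (enc k) s c) :
    LegalAll N c (simulate k (toChildren msg upd)) ∧
      ∃ s', (toChildren msg upd).Result N s s' ∧
        HoldsCopies N (enc k) s' (execAll N c (simulate k (toChildren msg upd))) := by
  classical
  obtain ⟨h1, h0⟩ := announce_sent (fun _ i => (none, i)) hc
  refine ⟨⟨announce_legal _, reply_legal _ (fun _ _ => rfl) h0, trivial, trivial, trivial⟩, _,
    fun _ => rfl, ?_⟩
  rw [holdsCopies_iff] at hc
  refine exec_collectOwn_conclude (c := exec N (exec N c _) _) upd (fun _ => none)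
    hc _ _ (fun g u v hm => ?_) (fun g hm => ?_) fun f => rfl
  · obtain ⟨f, hv, -⟩ := exists_frag_mwoe hm
    rw [exec_round_buf, sent, if_pos ⟨by rw [hv]; simp, (adj_mwoe hm).symm⟩]
    change Option.map (fun _ => (some (msg (c.st v).val), 0)) _ = _
    cases hp : N.parent g with
    | none =>
      rw [h0 u v]
      · rfl
      · rintro g' ⟨hm', hp'⟩
        have := frag_mwoe hm
        rw [frag_mwoe hm'] at this
        rw [Option.some_injective _ this, hp] at hp'
        cases hp'
    | some f' =>
      have hl : N.Link g u v := ⟨hm, by rw [hp]; rfl⟩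
      have := parent_eq_of_link hl
      rw [hp, hv] at this
      rw [h1 g u v hl, hc v f hv, Option.some_injective _ this]
      rfl
  · cases hp : N.parent g with
    | none => rfl
    | some f =>
      obtain ⟨u, v, h, -⟩ := frag_of_parent hp
      rw [hm] at h
      cases h

theorem simulate_toOneChild [Fintype M] (hid : ∀ v, N.id v < 2 ^ k) (msg : σ → M)
    (upd : σ → Option M → σ) (hc : HoldsCopies N (enc k) s c) :
    LegalAll N c (simulate k (toOneChild msg upd)) ∧
      ∃ s', (toOneChild msg upd).Result N s s' ∧
        HoldsCopies N (enc k) s' (execAll N c (simulate k (toOneChild msg upd))) := by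
  classical
  obtain ⟨h1, h0⟩ := announce_sent (fun _ i => (none, i)) hc
  refine ⟨⟨announce_legal _, trivial, trivial,
    reply_legal _ (fun s p => if_neg fun h => h.1 rfl) h0, trivial, trivial, trivial⟩, ?_⟩
  rw [holdsCopies_iff] at hc
  set A : F → Option (SimMsg M k) := fun f => aggregate (anySemigroup _) (N.children f)
    fun g => some (none, N.shortFid k g) with hA
  have hsel : ∀ f, ∃ o : Option F, A f = o.map (fun g => (none, N.shortFid k g)) ∧
      (∀ g, o = some g → N.parent g = some f) ∧ ((∃ g, N.parent g = some f) → o ≠ none) := by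
    intro f
    obtain ⟨hn, hs⟩ := aggregate_selects (anySemigroup (SimMsg M k)) anySemigroup_selective
      (N.children f) fun g => some (none, N.shortFid k g)
    cases ha : A f with
    | none =>
      refine ⟨none, rfl, by simp, ?_⟩
      rintro ⟨g, hg⟩
      exact absurd (hn ha g (mem_children.2 hg)) (by simp)
    | some m =>
      obtain ⟨g, hg, hm⟩ := hs m ha
      refine ⟨some g, ?_, ?_, by simp⟩
      · rw [← hm]; rfl
      · rintro g' h
        rw [← Option.some_injective _ h]
        exact mem_children.1 hg
  choose sel hselA hsel1 hsel2 using hsel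
  refine ⟨fun f => upd (s f) ((N.parent f).bind fun g => if sel g = some f then some (msg (s g))
    else none), ⟨sel, hsel1, hsel2, fun f => ⟨fun g hg => ?_, fun h => ?_⟩⟩, ?_⟩
  · beta_reduce
    rw [hsel1 g f hg, Option.bind_some, if_pos hg]
  · beta_reduce
    cases N.parent f with
    | none => rfl
    | some g => rw [Option.bind_some, if_neg (h g)]
  set c1 := exec N c (announce fun _ i => (none, i)) with hc1
  set c2 := exec N c1 (collectAll (anySemigroup _)) with hc2
  set c3 := exec N c2 (.broadcast load fun s m => s.store (some m)) with hc3
  have hb3 : c3.buf = c1.buf := rfl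
  have hst : ∀ v f, N.frag v = some f →
      c3.st v = N.simState s f (some ((A f).getD (none, 0))) := by
    intro v f hv
    have h2 : c2.st (N.leader f) = N.simState s f (A f) := by
      rw [hc2, collectAll, exec_convergecast_st _ _ _ _ _ _ _ (N.frag_leader f), if_pos rfl,
        aggregate_children _ _ f (fun g => (none, N.shortFid k g)) h1 h0]
      change store (c.st _) _ = _
      rw [hc _ f (N.frag_leader f)]
      rfl
    have h3 : ∀ r, store (c2.st v) r = N.simState s f r := by
      intro r
      rw [hc2, collectAll, exec_convergecast_st _ _ _ _ _ _ _ hv]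
      change store (ite _ (store (c.st v) _) (c.st v)) r = _
      rw [hc _ f hv]
      split_ifs <;> rfl
    rw [hc3, exec_broadcast_st _ _ _ hv, h2, h3]
    rfl
  refine exec_collectOwn_conclude (c := exec N c3 _) upd (fun f => some ((A f).getD (none, 0)))
    hst _ _ (fun g u v hm => ?_) (fun g hm => ?_) fun f => rfl
  · obtain ⟨f, hv, -⟩ := exists_frag_mwoe hm
    rw [exec_round_buf, sent, if_pos ⟨by rw [hv]; simp, (adj_mwoe hm).symm⟩, hb3, hst v f hv]
    cases hp : N.parent g with
    | none =>
      rw [h0 u v, if_neg fun h => h.1 rfl]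
      · rfl
      · rintro g' ⟨hm', hp'⟩
        have := frag_mwoe hm
        rw [frag_mwoe hm'] at this
        rw [Option.some_injective _ this, hp] at hp'
        cases hp'
    | some f' =>
      have hl : N.Link g u v := ⟨hm, by rw [hp]; rfl⟩
      have := parent_eq_of_link hl
      rw [hp, hv] at this
      obtain rfl := Option.some_injective _ this
      rw [h1 g u v hl, Option.bind_some]
      have hiff : (some (none, N.shortFid k g) =
          (N.simState s f' (some ((A f').getD (none, 0)))).scratch) ↔ sel f' = some g := by
        simp only [simState, hselA]
        obtain ⟨g', hg'⟩ := Option.ne_none_iff_exists'.1 (hsel2 f' ⟨g, hp⟩)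
        rw [hg']
        simp only [Option.map_some, Option.getD_some, Option.some.injEq, Prod.mk.injEq, true_and]
        exact ⟨fun h => (shortFid_injective hid h).symm, fun h => by rw [h]⟩
      by_cases h : sel f' = some g
      · rw [if_pos ⟨by simp, hiff.2 h⟩, if_pos h]
        rfl
      · rw [if_neg fun h' => h (hiff.1 h'.2), if_neg h]
        rfl
  · cases hp : N.parent g with
    | none => rfl
    | some f =>
      obtain ⟨u, v, h, -⟩ := frag_of_parent hp
      rw [hm] at h
      cases h

/-- Communication cycles and rounds over MWOEs simulate a virtual round. -/
theorem simulate_correct [Fintype M] (hid : ∀ v, N.id v < 2 ^ k) (st : VStep σ M)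
    (hc : HoldsCopies N (enc k) s c) :
    LegalAll N c (simulate k st) ∧
      ∃ s', st.Result N s s' ∧ HoldsCopies N (enc k) s' (execAll N c (simulate k st)) := by
  cases st with
  | toChildren msg upd => exact simulate_toChildren msg upd hc
  | toOneChild msg upd => exact simulate_toOneChild hid msg upd hc
  | toParent op msg upd => exact simulate_toParent op msg upd hc

theorem cycles_simulate_le [Fintype M] (k : ℕ) (st : VStep σ M) :
    ((simulate k st).map CStep.cycles).sum ≤ 4 := by
  cases st <;> simp [simulate, announce, collectAll, collectOwn, conclude, CStep.cycles]

theorem rounds_simulate_le [Fintype M] (k : ℕ) (st : VStep σ M) :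
    ((simulate k st).map CStep.rounds).sum ≤ 4 := by
  cases st <;> simp [simulate, announce, collectAll, collectOwn, conclude, CStep.rounds]

end VStep

/-! ### Cole–Vishkin color reduction -/

/-- The Cole–Vishkin color of a node of color `x` whose parent has color `y`: the position of the
lowest bit in which `x` and `y` differ, together with this bit of `x`. -/
noncomputable def coleVishkin (x : ℕ) : Option ℕ → ℕ
  | none => (x.testBit 0).toNat
  | some y => 2 * sInf {i | x.testBit i ≠ y.testBit i} +
      (x.testBit (sInf {i | x.testBit i ≠ y.testBit i})).toNat

theorem testBit_sInf_ne {x y : ℕ} (h : x ≠ y) :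
    x.testBit (sInf {i | x.testBit i ≠ y.testBit i}) ≠
      y.testBit (sInf {i | x.testBit i ≠ y.testBit i}) := by
  refine Nat.sInf_mem (s := {i | x.testBit i ≠ y.testBit i}) ?_
  by_contra hn
  exact h (Nat.eq_of_testBit_eq fun i => by_contra fun hi => hn ⟨i, hi⟩)

theorem coleVishkin_ne {x y : ℕ} (h : x ≠ y) (z : Option ℕ) (hz : ∀ w, z = some w → y ≠ w) :
    coleVishkin x (some y) ≠ coleVishkin y z := by
  intro he
  have hx := testBit_sInf_ne h
  set i := sInf {i | x.testBit i ≠ y.testBit i} with hi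
  have hbit : ∀ b : Bool, b.toNat < 2 := fun b => by cases b <;> simp
  have hinj : ∀ b c : Bool, b.toNat = c.toNat → b = c := fun b c => by
    cases b <;> cases c <;> simp
  cases z with
  | none =>
    simp only [coleVishkin, ← hi] at he
    have h1 := hbit (x.testBit i)
    have h2 := hbit (y.testBit 0)
    have h0 : i = 0 := by omega
    rw [h0] at he hx
    exact hx (hinj _ _ (by omega))
  | some w =>
    simp only [coleVishkin, ← hi] at he
    set j := sInf {i | y.testBit i ≠ w.testBit i}
    have h1 := hbit (x.testBit i)
    have h2 := hbit (y.testBit j)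
    have h0 : j = i := by omega
    rw [h0] at he
    exact hx (hinj _ _ (by omega))

theorem coleVishkin_lt {x m : ℕ} (hm : 1 ≤ m) (hx : x < 2 ^ m) (y : Option ℕ)
    (hy : ∀ w, y = some w → x ≠ w ∧ w < 2 ^ m) : coleVishkin x y < 2 * m := by
  have hbit : ∀ b : Bool, b.toNat < 2 := fun b => by cases b <;> simp
  cases y with
  | none =>
    have := hbit (x.testBit 0)
    simp only [coleVishkin]
    omega
  | some w =>
    obtain ⟨hne, hw⟩ := hy w rfl
    have hs := testBit_sInf_ne hne
    simp only [coleVishkin]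
    set i := sInf {i | x.testBit i ≠ w.testBit i}
    have := hbit (x.testBit i)
    have hi : i < m := by
      by_contra hi
      have hp := Nat.pow_le_pow_right (n := 2) (by omega) (not_lt.1 hi)
      rw [Nat.testBit_eq_false_of_lt (hx.trans_le hp),
        Nat.testBit_eq_false_of_lt (hw.trans_le hp)] at hs
      exact hs rfl
    omega

theorem logStar_of_le {n : ℕ} (h : n ≤ 1) : logStar n = 0 := by
  rw [logStar, dif_pos h]

theorem logStar_of_lt {n : ℕ} (h : 1 < n) : logStar n = logStar (Nat.clog 2 n) + 1 := by
  rw [logStar, dif_neg (by omega)]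

theorem clog_le_logBits (n : ℕ) : Nat.clog 2 n ≤ logBits n :=
  Nat.clog_le_of_le_pow (Nat.lt_pow_succ_log_self (by omega) n).le

theorem logBits_le_clog (n : ℕ) : logBits n ≤ Nat.clog 2 n + 1 :=
  Nat.succ_le_succ (Nat.log_le_clog 2 n)

/-! ### The GKP phase as a virtual algorithm -/

/-- State of a fragment in the GKP phase; all components are numbers of `k` bits. -/
structure GKPState (k : ℕ) where
  /-- the identity of the fragment -/
  fid : Fin (2 ^ k)
  /-- the identity of the parent -/
  par : Option (Fin (2 ^ k))
  /-- the color -/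
  color : Fin (2 ^ k)
  /-- the color before the last shift -/
  old : Fin (2 ^ k)
  /-- the identity of the mate -/
  mate : Option (Fin (2 ^ k))
  /-- the identity of the fragment to which the fragment attaches -/
  attach : Option (Fin (2 ^ k))

/-- Messages of the GKP phase: an optional number of `k` bits. -/
abbrev GKPMsg (k : ℕ) : Type := Option (Fin (2 ^ k))

namespace GKPState

variable {k : ℕ}

/-- The components of a state. -/
def toProd (s : GKPState k) : (Fin (2 ^ k) × Fin (2 ^ k) × Fin (2 ^ k)) ×
    Option (Fin (2 ^ k)) × Option (Fin (2 ^ k)) × Option (Fin (2 ^ k)) :=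
  ((s.fid, s.color, s.old), s.par, s.mate, s.attach)

theorem toProd_injective : Function.Injective (toProd : GKPState k → _) := by
  rintro ⟨⟩ ⟨⟩ h
  simp only [toProd, Prod.mk.injEq] at h
  simp [h]

noncomputable instance : Fintype (GKPState k) := Fintype.ofInjective toProd toProd_injective

theorem card_msg_le (k : ℕ) : Fintype.card (Option (Fin (2 ^ k))) ≤ 2 ^ (k + 1) := by
  rw [Fintype.card_option, Fintype.card_fin, pow_succ]
  have : 1 ≤ 2 ^ k := Nat.one_le_two_pow
  omega

theorem card_le (k : ℕ) : Fintype.card (GKPState k) ≤ 2 ^ (6 * k + 3) := by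
  refine (Fintype.card_le_of_injective _ toProd_injective).trans ?_
  have h := card_msg_le k
  rw [Fintype.card_prod, Fintype.card_prod, Fintype.card_prod, Fintype.card_prod (Option _),
    Fintype.card_prod (Option _), Fintype.card_fin]
  calc _ ≤ (2 ^ k * (2 ^ k * 2 ^ k)) * (2 ^ (k + 1) * (2 ^ (k + 1) * 2 ^ (k + 1))) := by gcongr
    _ = _ := by rw [← pow_add, ← pow_add, ← pow_add, ← pow_add, ← pow_add]; congr 1; ring

/-- The initial state. -/
def start (k : ℕ) (i : ℕ) (p : Option ℕ) : GKPState k :=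
  ⟨Fin.ofNat _ i, p.map (Fin.ofNat _), Fin.ofNat _ i, 0, none, none⟩

/-- The output. -/
def out (s : GKPState k) : GKPOutput :=
  ⟨Fin.ofNat 3 s.color, s.mate.map Fin.val, s.attach.map Fin.val⟩

end GKPState

/-- A color in `{0, 1, 2}` that avoids the color of the parent and that of the children. -/
def freeColor (p : Option ℕ) (q : ℕ) : ℕ :=
  if p ≠ some 0 ∧ q ≠ 0 then 0 else if p ≠ some 1 ∧ q ≠ 1 then 1 else 2

theorem freeColor_spec (p : Option ℕ) (q : ℕ) :
    freeColor p q < 3 ∧ p ≠ some (freeColor p q) ∧ q ≠ freeColor p q := by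
  unfold freeColor
  split_ifs with h1 h2
  · exact ⟨by omega, h1⟩
  · exact ⟨by omega, h2⟩
  · refine ⟨by omega, ?_⟩
    cases p with
    | none => simp at h1 h2; omega
    | some p => simp at h1 h2 ⊢; omega

namespace GKP

open VStep

variable {k : ℕ}

/-- A message as the number that it carries. -/
def msgVal (m : Option (GKPMsg k)) : Option ℕ := m.join.map Fin.val

/-- One Cole–Vishkin step. -/
noncomputable def colorStep (k : ℕ) : VStep (GKPState k) (GKPMsg k) :=
  .toChildren (fun s => some s.color)
    fun s m => { s with color := Fin.ofNat _ (coleVishkin s.color (msgVal m)) }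

/-- Every node takes the color of its parent; roots change their colors. -/
def shiftStep (k : ℕ) : VStep (GKPState k) (GKPMsg k) :=
  .toChildren (fun s => some s.color)
    fun s m => { s with
      color := Fin.ofNat _ ((msgVal m).getD (if s.color.val = 0 then 1 else 0))
      old := s.color }

/-- The nodes of color `c` choose new colors. -/
def recolorStep (k c : ℕ) : VStep (GKPState k) (GKPMsg k) :=
  .toChildren (fun s => some s.color)
    fun s m => if s.color.val = c then
      { s with color := Fin.ofNat _ (freeColor (msgVal m) s.old) } else s

/-- Removal of the colors `3, …, j + 2`. -/
def reduceColors (k : ℕ) : ℕ → List (VStep (GKPState k) (GKPMsg k))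
  | 0 => []
  | j + 1 => shiftStep k :: recolorStep k (j + 3) :: reduceColors k j

/-- The minimum of two optional numbers, where missing numbers are ignored. -/
@[reducible] noncomputable def msgMin (k : ℕ) : CommSemigroup (GKPMsg k) :=
  (optionMonoid (minSemigroup _)).toCommSemigroup

/-- The unmatched nodes of color `c` choose mates among their unmatched children. -/
noncomputable def proposeStep (k c : ℕ) : VStep (GKPState k) (GKPMsg k) :=
  .toParent (msgMin k) (fun s => if s.mate = none then some s.fid else none)
    fun s m => if s.color.val = c ∧ s.mate = none then { s with mate := m.join } else s

/-- Every node learns whether it is the mate of its parent. -/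
def acceptStep (k : ℕ) : VStep (GKPState k) (GKPMsg k) :=
  .toChildren (fun s => s.mate)
    fun s m => if m = some (some s.fid) then { s with mate := s.par } else s

/-- The unmatched nodes attach to their parents or, if they are roots, to children. -/
noncomputable def attachStep (k : ℕ) : VStep (GKPState k) (GKPMsg k) :=
  .toParent (msgMin k) (fun s => some s.fid)
    fun s m => if s.mate = none then { s with attach := s.par.or m.join } else s

/-- The GKP phase. -/
noncomputable def phase (k r j : ℕ) : List (VStep (GKPState k) (GKPMsg k)) :=
  List.replicate r (colorStep k) ++ (reduceColors k j ++
    [proposeStep k 0, acceptStep k, proposeStep k 1, acceptStep k, proposeStep k 2, acceptStep k,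
      attachStep k])

theorem length_reduceColors (k j : ℕ) : (reduceColors k j).length = 2 * j := by
  induction j with
  | zero => rfl
  | succ j ih => simp only [reduceColors, List.length_cons, ih]; omega

theorem length_phase (k r j : ℕ) : (phase k r j).length = r + 2 * j + 7 := by
  simp [phase, length_reduceColors]
  omega

variable {V F B : Type} [Fintype V] [Fintype F] [Fintype B] {N : Network V F B}

theorem resultAll_append {σ M : Type} {P Q : List (VStep σ M)} {s s' : F → σ} :
    ResultAll N (P ++ Q) s s' ↔ ∃ t, ResultAll N P s t ∧ ResultAll N Q t s' := by
  induction P generalizing s with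
  | nil => exact ⟨fun h => ⟨s, rfl, h⟩, fun ⟨t, h, h'⟩ => h ▸ h'⟩
  | cons st P ih =>
    simp only [List.cons_append, ResultAll, ih]
    exact ⟨fun ⟨t, h, t', h1, h2⟩ => ⟨t', ⟨t, h, h1⟩, h2⟩,
      fun ⟨t', ⟨t, h, h1⟩, h2⟩ => ⟨t, h, t', h1, h2⟩⟩

/-- Every fragment knows its identity and that of its parent. -/
def Knows (N : Network V F B) (s : F → GKPState k) : Prop :=
  ∀ f, (s f).fid = N.shortFid k f ∧ (s f).par = (N.parent f).map (N.shortFid k)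

/-- Nothing has been computed except for a proper coloring with colors below `b`. -/
structure Colored (N : Network V F B) (b : ℕ) (s : F → GKPState k) : Prop where
  knows : Knows N s
  lt : ∀ f, (s f).color.val < b
  ne : ∀ f g, N.parent f = some g → (s f).color.val ≠ (s g).color.val
  mate : ∀ f, (s f).mate = none
  attach : ∀ f, (s f).attach = none

theorem Colored.mono {b b' : ℕ} {s : F → GKPState k} (h : Colored N b s) (hb : b ≤ b') :
    Colored N b' s :=
  ⟨h.knows, fun f => (h.lt f).trans_le hb, h.ne, h.mate, h.attach⟩

theorem msgVal_map (s : F → GKPState k) (f : F) :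
    msgVal ((N.parent f).map fun g => (some (s g).color : GKPMsg k)) =
      (N.parent f).map fun g => (s g).color.val := by
  cases N.parent f <;> rfl

theorem colored_start (hid : ∀ v, N.id v < 2 ^ k) :
    Colored N (2 ^ k) fun f => GKPState.start k (N.fid f) ((N.parent f).map N.fid) where
  knows f := ⟨rfl, by simp only [GKPState.start, Option.map_map]; rfl⟩
  lt f := Fin.isLt _
  ne f g h he := by
    have : N.shortFid k f = N.shortFid k g := Fin.ext he
    exact Network.parent_ne_self h (Network.shortFid_injective hid this).symm
  mate _ := rfl
  attach _ := rfl

theorem colored_colorStep {m : ℕ} (hm : 1 ≤ m) (hk : 2 * m ≤ 2 ^ k) {s s' : F → GKPState k}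
    (h : Colored N (2 ^ m) s) (hs : (colorStep k).Result N s s') : Colored N (2 * m) s' := by
  have hs : ∀ f, s' f = { s f with color := Fin.ofNat _ (coleVishkin (s f).color
      ((N.parent f).map fun g => (s g).color.val)) } := by
    intro f
    rw [← msgVal_map]
    exact hs f
  have hlt : ∀ f, coleVishkin (s f).color ((N.parent f).map fun g => (s g).color.val) < 2 * m := by
    refine fun f => coleVishkin_lt hm (h.lt f) _ fun w hw => ?_
    obtain ⟨g, hg, rfl⟩ := Option.map_eq_some_iff.1 hw
    exact ⟨h.ne f g hg, h.lt g⟩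
  have hc : ∀ f, (s' f).color.val =
      coleVishkin (s f).color ((N.parent f).map fun g => (s g).color.val) := by
    intro f
    rw [hs]
    exact Nat.mod_eq_of_lt ((hlt f).trans_le hk)
  refine ⟨fun f => ?_, fun f => (hc f).trans_lt (hlt f), fun f g hfg => ?_, fun f => ?_,
    fun f => ?_⟩
  · rw [hs]
    exact h.knows f
  · rw [hc, hc, hfg]
    refine coleVishkin_ne (h.ne f g hfg) _ fun w hw => ?_
    obtain ⟨g', hg, rfl⟩ := Option.map_eq_some_iff.1 hw
    exact h.ne g g' hg
  · rw [hs]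
    exact h.mate f
  · rw [hs]
    exact h.attach f

/-- `O(log* n)` Cole–Vishkin steps reduce the number of colors to a constant. -/
theorem colored_colorSteps {a x : ℕ} (hk : 2 ^ (a + 4) * (Nat.clog 2 x + 1) ≤ 2 ^ k)
    {s s' : F → GKPState k} (h : Colored N (2 ^ (a + 4) * (x + 1)) s)
    (hs : ResultAll N (List.replicate (logStar x) (colorStep k)) s s') :
    Colored N (2 ^ (a + 4) * 2) s' := by
  have ha : a + 1 ≤ 2 ^ a := Nat.lt_two_pow_self
  have ha4 : 2 ^ (a + 4) = 16 * 2 ^ a := by rw [pow_add]; ring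
  induction hn : logStar x generalizing x s with
  | zero =>
    have hx : x ≤ 1 := by
      by_contra hx
      rw [logStar_of_lt (by omega)] at hn
      omega
    rw [hn] at hs
    rw [show s' = s from hs]
    exact h.mono (Nat.mul_le_mul_left _ (by omega))
  | succ r ih =>
    have hx : 1 < x := by
      by_contra hx
      rw [logStar_of_le (by omega)] at hn
      omega
    have hr : logStar (Nat.clog 2 x) = r := by
      rw [logStar_of_lt hx] at hn
      omega
    rw [hn, List.replicate_succ] at hs
    obtain ⟨t, h1, h2⟩ := hs
    have hx2 : x ≤ 2 ^ Nat.clog 2 x := Nat.le_pow_clog (by omega) x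
    have hle : 2 * (a + 4 + (Nat.clog 2 x + 1)) ≤ 2 ^ (a + 4) * (Nat.clog 2 x + 1) := by
      rw [ha4]
      nlinarith
    have hc : Colored N (2 ^ (a + 4 + (Nat.clog 2 x + 1))) s := by
      refine h.mono ?_
      rw [pow_add 2 (a + 4)]
      refine Nat.mul_le_mul_left _ ?_
      rw [pow_succ]
      omega
    have hcl : Nat.clog 2 (Nat.clog 2 x) ≤ Nat.clog 2 x :=
      Nat.clog_le_of_le_pow Nat.lt_two_pow_self.le
    have hk' : 2 ^ (a + 4) * (Nat.clog 2 (Nat.clog 2 x) + 1) ≤ 2 ^ k :=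
      (Nat.mul_le_mul_left _ (by omega)).trans hk
    refine ih hk' ((colored_colorStep (by omega) (hle.trans hk) hc h1).mono hle) ?_ hr
    rw [hr]
    exact h2

theorem colored_reduce_step (hk : 3 ≤ 2 ^ k) {c : ℕ} (hc : 3 ≤ c) {s t s' : F → GKPState k}
    (h : Colored N (c + 1) s) (hs : (shiftStep k).Result N s t)
    (hs' : (recolorStep k c).Result N t s') : Colored N c s' := by
  have ht : ∀ f, t f = { s f with
      color := Fin.ofNat _ (((N.parent f).map fun g => (s g).color.val).getD
        (if (s f).color.val = 0 then 1 else 0))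
      old := (s f).color } := by
    intro f
    rw [← msgVal_map]
    exact hs f
  have htc : ∀ f, (t f).color.val = ((N.parent f).map fun g => (s g).color.val).getD
        (if (s f).color.val = 0 then 1 else 0) := by
    intro f
    rw [ht]
    refine Nat.mod_eq_of_lt ?_
    cases N.parent f with
    | none => simp only [Option.map_none, Option.getD_none]; split_ifs <;> omega
    | some g => exact Fin.isLt _
  have hto : ∀ f, (t f).old = (s f).color := fun f => by rw [ht]
  have htl : ∀ f, (t f).color.val < c + 1 := by
    intro f
    rw [htc]
    cases N.parent f with
    | none => simp only [Option.map_none, Option.getD_none]; split_ifs <;> omega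
    | some g => exact h.lt g
  have htn : ∀ f, (t f).color.val ≠ (s f).color.val := by
    intro f
    rw [htc]
    cases hp : N.parent f with
    | none => simp only [Option.map_none, Option.getD_none]; split_ifs <;> omega
    | some g => exact (h.ne f g hp).symm
  have htch : ∀ f g, N.parent f = some g → (t f).color.val = (s g).color.val := by
    intro f g hp
    rw [htc, hp]
    rfl
  have hs : ∀ f, s' f = if (t f).color.val = c then
      { t f with
        color := Fin.ofNat _ (freeColor ((N.parent f).map fun g => (t g).color.val) (s f).color) }
      else t f := by
    intro f
    rw [← msgVal_map, ← hto]
    exact hs' f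
  have hsp := fun f => freeColor_spec ((N.parent f).map fun g => (t g).color.val) (s f).color
  have hsc : ∀ f, (s' f).color.val = if (t f).color.val = c then
      freeColor ((N.parent f).map fun g => (t g).color.val) (s f).color else (t f).color.val := by
    intro f
    rw [hs]
    split_ifs
    · exact Nat.mod_eq_of_lt ((hsp f).1.trans_le hk)
    · rfl
  refine ⟨fun f => ?_, fun f => ?_, fun f g hfg => ?_, fun f => ?_, fun f => ?_⟩
  · have := h.knows f
    rw [hs, ht]
    split_ifs <;> exact this
  · rw [hsc]
    split_ifs with h'
    · exact (hsp f).1.trans_le hc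
    · have := htl f
      omega
  · have h1 := htch f g hfg
    have h2 := htn g
    have h3 := (hsp f).2.1
    have h4 := (hsp g).2.2
    rw [hfg] at h3
    simp only [Option.map_some, ne_eq, Option.some.injEq] at h3
    rw [hsc, hsc]
    split_ifs with h5 h6 h6
    · omega
    · rw [hfg]
      exact Ne.symm h3
    · omega
    · omega
  · rw [hs, ht]
    split_ifs <;> exact h.mate f
  · rw [hs, ht]
    split_ifs <;> exact h.attach f

theorem colored_reduceColors (hk : 3 ≤ 2 ^ k) {j : ℕ} {s s' : F → GKPState k}
    (h : Colored N (j + 3) s) (hs : ResultAll N (reduceColors k j) s s') : Colored N 3 s' := by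
  induction j generalizing s with
  | zero => rwa [show s' = s from hs]
  | succ j ih =>
    obtain ⟨t, h1, t', h2, h3⟩ := hs
    exact ih (colored_reduce_step hk (by omega) (h.mono (by omega)) h1 h2) h3

/-- There is a proper 3-coloring and a matching `mt` such that the nodes of colors below `c` cannot
be matched with children. -/
structure Matched (N : Network V F B) (c : ℕ) (mt : F → Option F) (s : F → GKPState k) : Prop where
  knows : Knows N s
  lt : ∀ f, (s f).color.val < 3
  ne : ∀ f g, N.parent f = some g → (s f).color.val ≠ (s g).color.val
  attach : ∀ f, (s f).attach = none
  mate : ∀ f, (s f).mate = (mt f).map (N.shortFid k)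
  symm : ∀ f g, mt f = some g → mt g = some f
  adj : ∀ f g, mt f = some g → N.VAdj f g
  maximal : ∀ f g, N.parent g = some f → (s f).color.val < c → mt f ≠ none ∨ mt g ≠ none

theorem matched_of_colored {s : F → GKPState k} (h : Colored N 3 s) :
    Matched N 0 (fun _ => none) s :=
  ⟨h.knows, h.lt, h.ne, h.attach, h.mate, fun _ _ h => (nomatch h), fun _ _ h => (nomatch h),
    fun _ _ _ h => absurd h (Nat.not_lt_zero _)⟩

/-- The minimum over all children of optional numbers. -/
theorem aggregate_children_min (f : F) (x : F → GKPMsg k) :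
    (∀ i, (aggregate (msgMin k) (N.children f) fun g => some (x g)).join = some i →
        ∃ g, N.parent g = some f ∧ x g = some i) ∧
      ((aggregate (msgMin k) (N.children f) fun g => some (x g)).join = none →
        ∀ g, N.parent g = some f → x g = none) := by
  have h : (aggregate (msgMin k) (N.children f) fun g => some (x g)).join =
      aggregate (minSemigroup _) (N.children f) x := by
    refine aggregate_comp (msgMin k) (minSemigroup _) Option.join rfl (fun a b => ?_) _ _
    cases a with
    | none => rw [combine_none_left]; exact (combine_none_left _ _).symm
    | some a =>
      cases b with
      | none => rw [combine_none_right]; exact (combine_none_right _ _).symm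
      | some b => rfl
  obtain ⟨h1, h2⟩ := aggregate_selects _ minSemigroup_selective (N.children f) x
  rw [h]
  refine ⟨fun i hi => ?_, fun hn g hg => h1 hn g (Network.mem_children.2 hg)⟩
  obtain ⟨g, hg, hx⟩ := h2 i hi
  exact ⟨g, Network.mem_children.1 hg, hx⟩

theorem matched_step (hid : ∀ v, N.id v < 2 ^ k) {c : ℕ} {mt : F → Option F}
    {s t s' : F → GKPState k} (h : Matched N c mt s) (hs : (proposeStep k c).Result N s t)
    (hs' : (acceptStep k).Result N t s') : ∃ mt', Matched N (c + 1) mt' s' := by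
  classical
  have hinj := Network.shortFid_injective hid
  have hs : ∀ f, t f = if (s f).color.val = c ∧ (s f).mate = none then
      { s f with mate := (aggregate (msgMin k) (N.children f) fun g => some
          (if (s g).mate = none then some (s g).fid else none)).join } else s f := hs
  have hs' : ∀ f, s' f = if ((N.parent f).map fun g => (t g).mate) = some (some (t f).fid) then
      { t f with mate := (t f).par } else t f := hs'
  have hmate : ∀ f, (s f).mate = none ↔ mt f = none := by
    intro f
    rw [h.mate, Option.map_eq_none_iff]
  -- the proposals
  have hpick : ∀ f, ∃ o : Option F, (t f).mate = ((mt f).or o).map (N.shortFid k) ∧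
      (∀ g, o = some g → N.parent g = some f ∧ (s f).color.val = c ∧ mt f = none ∧ mt g = none) ∧
      (o = none → (s f).color.val = c → mt f = none → ∀ g, N.parent g = some f → mt g ≠ none) := by
    intro f
    have ht := hs f
    by_cases hf : (s f).color.val = c ∧ (s f).mate = none
    · have hmf := (hmate f).1 hf.2
      rw [if_pos hf] at ht
      obtain ⟨h1, h2⟩ := aggregate_children_min (N := N) f
        fun g => if (s g).mate = none then some (s g).fid else none
      rw [ht]
      cases ha : (aggregate (msgMin k) (N.children f) fun g => some
        (if (s g).mate = none then some (s g).fid else none)).join with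
      | none =>
        refine ⟨none, ?_, by simp, fun _ _ _ g hg hn => ?_⟩
        · rw [hmf]
          rfl
        · have := h2 ha g hg
          rw [if_pos ((hmate g).2 hn)] at this
          cases this
      | some i =>
        obtain ⟨g, hg, hx⟩ := h1 i ha
        split_ifs at hx with hng
        · refine ⟨some g, ?_, ?_, by simp⟩
          · rw [hmf]
            change some i = some (N.shortFid k g)
            rw [← hx, (h.knows g).1]
          · rintro g' hg'
            rw [← Option.some_injective _ hg']
            exact ⟨hg, hf.1, hmf, (hmate g).1 hng⟩
    · rw [if_neg hf] at ht
      refine ⟨none, ?_, by simp, fun _ hc hn => absurd ⟨hc, (hmate f).2 hn⟩ hf⟩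
      rw [ht, h.mate, Option.or_none]
  choose pick hpt hp1 hp2 using hpick
  have htk : Knows N t := by
    intro f
    rw [hs f]
    split_ifs <;> exact h.knows f
  have htcol : ∀ f, (t f).color = (s f).color := by
    intro f
    rw [hs f]
    split_ifs <;> rfl
  have htatt : ∀ f, (t f).attach = none := by
    intro f
    rw [hs f]
    split_ifs <;> exact h.attach f
  have hcol : ∀ f, (s' f).color = (s f).color := by
    intro f
    rw [hs' f, ← htcol]
    split_ifs <;> rfl
  -- the new matching
  let mt' : F → Option F := fun g =>
    if ∃ f, N.parent g = some f ∧ pick f = some g then N.parent g else (mt g).or (pick g)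
  have hacc : ∀ f g, pick f = some g → mt' g = some f := by
    intro f g hp
    have := (hp1 f g hp).1
    rw [show mt' g = N.parent g from if_pos ⟨f, this, hp⟩, this]
  have hkeep : ∀ f g, mt f = some g → mt' f = some g := by
    intro f g hm
    have : ¬ ∃ f', N.parent f = some f' ∧ pick f' = some f := by
      rintro ⟨f', -, hp⟩
      rw [(hp1 f' f hp).2.2.2] at hm
      cases hm
    rw [show mt' f = (mt f).or (pick f) from if_neg this, hm, Option.some_or]
  have hprop : ∀ f g, pick f = some g → mt' f = some g := by
    intro f g hp
    obtain ⟨-, hc, hm, -⟩ := hp1 f g hp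
    have : ¬ ∃ f', N.parent f = some f' ∧ pick f' = some f := by
      rintro ⟨f', hpar, hp'⟩
      exact h.ne f f' hpar (by rw [hc, (hp1 f' f hp').2.1])
    rw [show mt' f = (mt f).or (pick f) from if_neg this, hm, Option.none_or, hp]
  have hcases : ∀ f g, mt' f = some g → mt f = some g ∨ pick f = some g ∨ pick g = some f := by
    intro f g hm
    by_cases hex : ∃ f', N.parent f = some f' ∧ pick f' = some f
    · obtain ⟨f', hpar, hp⟩ := hex
      rw [hacc f' f hp] at hm
      rw [← Option.some_injective _ hm]
      exact Or.inr (Or.inr hp)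
    · rw [show mt' f = (mt f).or (pick f) from if_neg hex] at hm
      cases hmf : mt f with
      | none => rw [hmf, Option.none_or] at hm; exact Or.inr (Or.inl hm)
      | some f' => rw [hmf, Option.some_or] at hm; exact Or.inl hm
  refine ⟨mt', ⟨fun f => ?_, fun f => ?_, fun f g hfg => ?_, fun f => ?_, fun f => ?_,
    fun f g hfg => ?_, fun f g hfg => ?_, fun f g hfg hlt => ?_⟩⟩
  · rw [hs' f]
    split_ifs <;> exact htk f
  · rw [hcol]
    exact h.lt f
  · rw [hcol, hcol]
    exact h.ne f g hfg
  · rw [hs' f]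
    split_ifs <;> exact htatt f
  · have hiff : ((N.parent f).map fun g => (t g).mate) = some (some (t f).fid) ↔
        ∃ g, N.parent f = some g ∧ (mt g = some f ∨ pick g = some f) := by
      rw [Option.map_eq_some_iff]
      refine exists_congr fun g => and_congr_right fun _ => ?_
      rw [hpt, (htk f).1, Option.map_eq_some_iff]
      constructor
      · rintro ⟨f', ho, he⟩
        rw [hinj he] at ho
        cases hmg : mt g with
        | none => rw [hmg, Option.none_or] at ho; exact Or.inr ho
        | some f'' => rw [hmg, Option.some_or] at ho; exact Or.inl ho
      · rintro (hm | hp)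
        · exact ⟨f, by rw [hm, Option.some_or], rfl⟩
        · exact ⟨f, by rw [(hp1 g f hp).2.2.1, Option.none_or, hp], rfl⟩
    rw [hs' f]
    split_ifs with hm
    · obtain ⟨g, hg, hm⟩ := hiff.1 hm
      have : mt' f = some g := by
        rcases hm with hm | hp
        · exact hkeep f g (h.symm g f hm)
        · exact hacc g f hp
      rw [this, ← hg]
      exact (htk f).2
    · have : ¬ ∃ f', N.parent f = some f' ∧ pick f' = some f := fun ⟨g, hg, hp⟩ =>
        hm (hiff.2 ⟨g, hg, Or.inr hp⟩)
      rw [hpt, show mt' f = (mt f).or (pick f) from if_neg this]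
  · rcases hcases f g hfg with hm | hp | hp
    · exact hkeep g f (h.symm f g hm)
    · exact hacc f g hp
    · exact hprop g f hp
  · rcases hcases f g hfg with hm | hp | hp
    · exact h.adj f g hm
    · exact Or.inr (hp1 f g hp).1
    · exact Or.inl (hp1 g f hp).1
  · rw [hcol] at hlt
    have hk : ∀ f, mt f ≠ none → mt' f ≠ none := by
      intro f hf
      obtain ⟨g, hg⟩ := Option.ne_none_iff_exists'.1 hf
      rw [hkeep f g hg]
      simp
    by_cases hc : (s f).color.val < c
    · exact (h.maximal f g hfg hc).imp (hk f) (hk g)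
    · by_cases hmf : mt f = none
      · cases hpf : pick f with
        | none => exact Or.inr (hk g (hp2 f hpf (by omega) hmf g hfg))
        | some g' => left; rw [hprop f g' hpf]; simp
      · exact Or.inl (hk f hmf)

end GKP

/-! ### Joining matched pairs and attached fragments -/

/-- If the edges of a graph are a matching together with edges by which unmatched nodes attach to
matched nodes, then the components have diameter at most `3`. -/
theorem joinGraph_dist_le {F : Type} {mate attach : F → Option F}
    (hsymm : ∀ f g, mate f = some g → mate g = some f) (hirr : ∀ f, mate f ≠ some f)
    (hirr' : ∀ f, attach f ≠ some f)
    (hmatched : ∀ f, mate f ≠ none → attach f = none)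
    (hattach : ∀ f g, attach f = some g → mate g ≠ none) {f g : F}
    (h : (joinGraph mate attach).Reachable f g) : (joinGraph mate attach).dist f g ≤ 3 := by
  set J := joinGraph mate attach
  let ctr : F → F := fun f => (attach f).getD f
  have hadj : ∀ f g, mate f = some g ∨ attach f = some g → J.Adj f g := by
    intro f g hfg
    refine (SimpleGraph.fromRel_adj _ _ _).2 ⟨?_, Or.inl hfg⟩
    rintro rfl
    exact hfg.elim (hirr f) (hirr' f)
  have hctr : ∀ f, J.Reachable f (ctr f) ∧ J.dist f (ctr f) ≤ 1 := by
    intro f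
    cases ha : attach f with
    | none =>
      rw [show ctr f = f by simp [ctr, ha]]
      exact ⟨SimpleGraph.Reachable.refl _, by simp⟩
    | some g =>
      rw [show ctr f = g by simp [ctr, ha]]
      have := hadj f g (Or.inr ha)
      exact ⟨this.reachable, (SimpleGraph.dist_eq_one_iff_adj.2 this).le⟩
  have hstep : ∀ f g, mate f = some g ∨ attach f = some g →
      ctr f = ctr g ∨ mate (ctr f) = some (ctr g) := by
    intro f g hfg
    rcases hfg with hfg | hfg
    · right
      have h1 := hmatched f (by rw [hfg]; simp)
      have h2 := hmatched g (by rw [hsymm f g hfg]; simp)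
      rw [show ctr f = f by simp [ctr, h1], show ctr g = g by simp [ctr, h2], hfg]
    · left
      have h1 := hmatched g (hattach f g hfg)
      simp [ctr, hfg, h1]
  have hrel : ∀ {f g}, J.Reachable f g → ctr f = ctr g ∨ mate (ctr f) = some (ctr g) := by
    intro f g h
    obtain ⟨p⟩ := h
    induction p with
    | nil => exact Or.inl rfl
    | @cons f g l hfg _ ih =>
      have h1 : ctr f = ctr g ∨ mate (ctr f) = some (ctr g) := by
        rcases ((SimpleGraph.fromRel_adj _ _ _).1 hfg).2 with h' | h'
        · exact hstep f g h'
        · exact (hstep g f h').imp Eq.symm (hsymm _ _)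
      rcases h1 with h1 | h1
      · rwa [h1]
      · rcases ih with ih | ih
        · exact Or.inr (by rw [h1, ih])
        · rw [hsymm _ _ h1] at ih
          exact Or.inl (Option.some_injective _ ih)
  obtain ⟨h1, d1⟩ := hctr f
  obtain ⟨h2, d2⟩ := hctr g
  have d3 : J.dist (ctr f) (ctr g) ≤ 1 := by
    rcases hrel h with h' | h'
    · rw [h']; simp
    · exact (SimpleGraph.dist_eq_one_iff_adj.2 (hadj _ _ (Or.inl h'))).le
  have hc : J.Reachable (ctr f) (ctr g) := h1.symm.trans (h.trans h2)
  calc J.dist f g ≤ J.dist f (ctr f) + J.dist (ctr f) g := h1.dist_triangle_left g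
    _ ≤ J.dist f (ctr f) + (J.dist (ctr f) (ctr g) + J.dist (ctr g) g) :=
        Nat.add_le_add_left (hc.dist_triangle_left g) _
    _ ≤ 3 := by rw [J.dist_comm (u := ctr g)]; omega

namespace GKP

open VStep

variable {k : ℕ} {V F B : Type} [Fintype V] [Fintype F] [Fintype B] {N : Network V F B}

theorem vAdj_ne {f g : F} (h : N.VAdj f g) : f ≠ g := by
  rcases h with h | h
  · exact (Network.parent_ne_self h).symm
  · exact Network.parent_ne_self h

theorem output_of_matched (hid : ∀ v, N.id v < 2 ^ k) {mt : F → Option F}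
    {s s' : F → GKPState k} (h : Matched N 3 mt s) (hs : (attachStep k).Result N s s') :
    IsGKPOutput N fun f => (s' f).out := by
  have hmax : ∀ f g, N.VAdj f g → mt f ≠ none ∨ mt g ≠ none := by
    rintro f g (hp | hp)
    · exact (h.maximal g f hp (h.lt g)).symm
    · exact h.maximal f g hp (h.lt f)
  have hs : ∀ f, s' f = if (s f).mate = none then
      { s f with
        attach := (s f).par.or
          (aggregate (msgMin k) (N.children f) fun g => some (some (s g).fid)).join }
      else s f := hs
  have hatt : ∀ f, ∃ o : Option F, (s' f).attach = o.map (N.shortFid k) ∧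
      (mt f ≠ none → o = none) ∧ (∀ g, o = some g → N.VAdj f g ∧ mt g ≠ none) ∧
      (mt f = none → N.mwoe f ≠ none → o ≠ none) := by
    intro f
    have hf := hs f
    by_cases hm : mt f = none
    · rw [if_pos (by rw [h.mate, hm]; rfl)] at hf
      have key : ∃ o : Option F, (s' f).attach = o.map (N.shortFid k) ∧
          (∀ g, o = some g → N.VAdj f g) ∧ (N.mwoe f ≠ none → o ≠ none) := by
        rw [hf]
        cases hp : N.parent f with
        | some g =>
          refine ⟨some g, ?_, ?_, by simp⟩
          · change (s f).par.or _ = _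
            rw [(h.knows f).2, hp, Option.map_some, Option.some_or]
          · rintro g' hg'
            rw [← Option.some_injective _ hg']
            exact Or.inl hp
        | none =>
          obtain ⟨h1, h2⟩ := aggregate_children_min (N := N) f
            fun g => some (s g).fid
          have ho : ∀ o : Option (Fin (2 ^ k)), (s f).par.or o = o := by
            intro o
            rw [(h.knows f).2, hp, Option.map_none, Option.none_or]
          cases ha : (aggregate (msgMin k) (N.children f) fun g =>
            some (some (s g).fid)).join with
          | none =>
            refine ⟨none, ho _, by simp, fun hw => ?_⟩
            obtain ⟨g, hg⟩ := Network.exists_child_of_root hp hw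
            cases h2 ha g hg
          | some i =>
            obtain ⟨g, hg, hx⟩ := h1 i ha
            refine ⟨some g, (ho _).trans ?_, ?_, by simp⟩
            · rw [← hx, (h.knows g).1]
              rfl
            · rintro g' hg'
              rw [← Option.some_injective _ hg']
              exact Or.inr hg
      obtain ⟨o, h1, h2, h3⟩ := key
      exact ⟨o, h1, fun h' => absurd hm h',
        fun g hg => ⟨h2 g hg, (hmax f g (h2 g hg)).resolve_left fun h' => h' hm⟩, fun _ => h3⟩
    · refine ⟨none, ?_, fun _ => rfl, by simp, fun h' => absurd h' hm⟩
      rw [if_neg (by rwa [h.mate, Option.map_eq_none_iff])] at hf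
      rw [hf]
      exact h.attach f
  choose att ha1 ha2 ha3 ha4 using hatt
  have hcol : ∀ f, (s' f).color = (s f).color := by
    intro f
    rw [hs f]
    split_ifs <;> rfl
  have hmate : ∀ f, (s' f).mate = (mt f).map (N.shortFid k) := by
    intro f
    rw [← h.mate, hs f]
    split_ifs <;> rfl
  have hval : ∀ f, (Fin.ofNat 3 (s f).color.val).val = (s f).color.val := fun f =>
    Nat.mod_eq_of_lt (h.lt f)
  refine ⟨fun f => Fin.ofNat 3 (s f).color, mt, att,
    ⟨fun f g hfg he => ?_, h.symm, h.adj, hmax, ha2, ha3, ha4, fun f hf => ?_, fun f g hfg => ?_⟩,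
    fun f => ?_⟩
  · have he := congrArg Fin.val he
    rw [hval, hval] at he
    rcases hfg with hp | hp
    · exact h.ne f g hp he
    · exact h.ne g f hp he.symm
  · cases hm : mt f with
    | some g =>
      exact ⟨g, (SimpleGraph.fromRel_adj _ _ _).2 ⟨vAdj_ne (h.adj f g hm), Or.inl (Or.inl hm)⟩⟩
    | none =>
      obtain ⟨g, hg⟩ := Option.ne_none_iff_exists'.1 (ha4 f hm hf)
      exact ⟨g, (SimpleGraph.fromRel_adj _ _ _).2
        ⟨vAdj_ne (ha3 f g hg).1, Or.inl (Or.inr hg)⟩⟩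
  · exact joinGraph_dist_le h.symm (fun f hf => vAdj_ne (h.adj f f hf) rfl)
      (fun f hf => vAdj_ne (ha3 f f hf).1 rfl) ha2 (fun f g hg => (ha3 f g hg).2) hfg
  · have hv : ∀ o : Option F, (o.map (N.shortFid k)).map Fin.val = o.map N.fid := by
      intro o
      cases o with
      | none => rfl
      | some g => exact congrArg some (Network.shortFid_val hid g)
    simp only [GKPState.out, hcol, hmate, ha1, hv]

/-- The GKP phase is correct. -/
theorem phase_correct {n a L : ℕ} (hL : L = logBits n) (hN : HasSize N n a)
    {s' : F → GKPState ((a + 5) * L)}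
    (hs : ResultAll N (phase ((a + 5) * L) (1 + logStar n) (2 ^ (a + 4) * 2))
      (fun f => GKPState.start _ (N.fid f) ((N.parent f).map N.fid)) s') :
    IsGKPOutput N fun f => (s' f).out := by
  have hL1 : 1 ≤ L := hL ▸ Nat.le_add_left _ _
  have hid : ∀ v, N.id v < 2 ^ ((a + 5) * L) := fun v =>
    (hL ▸ hN.2 v).trans_le (Nat.pow_le_pow_right (by omega) (Nat.mul_le_mul_right _ (by omega)))
  have hk5 : 5 ≤ (a + 5) * L := by nlinarith
  have hk3 : 3 ≤ 2 ^ ((a + 5) * L) :=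
    le_trans (by norm_num) (Nat.pow_le_pow_right (n := 2) (by omega) hk5)
  have ha : a + 1 ≤ 2 ^ a := Nat.lt_two_pow_self
  have ha4 : 2 ^ (a + 4) = 16 * 2 ^ a := by rw [pow_add]; ring
  have hLn : L ≤ Nat.clog 2 n + 1 := hL ▸ logBits_le_clog n
  have hnL : Nat.clog 2 n ≤ L := hL ▸ clog_le_logBits n
  have hsize : 2 ^ (a + 4) * (Nat.clog 2 n + 1) ≤ 2 ^ ((a + 5) * L) := by
    have h1 : L + 1 ≤ 2 ^ L := Nat.lt_two_pow_self
    calc 2 ^ (a + 4) * (Nat.clog 2 n + 1) ≤ 2 ^ ((a + 4) * L) * 2 ^ L := by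
          refine Nat.mul_le_mul (Nat.pow_le_pow_right (by omega) ?_) (by omega)
          exact Nat.le_mul_of_pos_right _ hL1
      _ = _ := by rw [← pow_add]; congr 1; ring
  have hstep : 2 * ((a + 5) * L) ≤ 2 ^ (a + 4) * (Nat.clog 2 n + 1) := by
    rw [ha4]
    nlinarith
  rw [phase, resultAll_append] at hs
  obtain ⟨t1, h1, hs⟩ := hs
  rw [resultAll_append] at hs
  obtain ⟨t2, h2, t3, h3, t4, h4, t5, h5, t6, h6, t7, h7, t8, h8, t9, h9, h10⟩ := hs
  rw [List.replicate_add, resultAll_append] at h1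
  obtain ⟨t0, ⟨t', h0, h0'⟩, h1⟩ := h1
  rw [show t0 = t' from h0'] at h1
  have c0 := colored_colorStep (by omega) (hstep.trans hsize) (colored_start hid) h0
  have c1 : Colored N (2 ^ (a + 4) * 2) t1 := by
    refine colored_colorSteps hsize (c0.mono (hstep.trans (Nat.mul_le_mul_left _ ?_))) h1
    exact Nat.succ_le_succ (Nat.clog_le_of_le_pow Nat.lt_two_pow_self.le)
  have c2 := colored_reduceColors hk3 (c1.mono (by omega)) h2
  obtain ⟨m1, k1⟩ := matched_step hid (matched_of_colored c2) h3 h4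
  obtain ⟨m2, k2⟩ := matched_step hid k1 h5 h6
  obtain ⟨m3, k3⟩ := matched_step hid k2 h7 h8
  obtain rfl : s' = t9 := h10
  exact output_of_matched hid k3 h9

end GKP

/-! ### Sequences of steps -/

namespace CStep

variable {V F B : Type} [Fintype V] [Fintype F] [Fintype B] {N : Network V F B} {σ M : Type}

theorem execAll_append (c : Conf V σ M) (P Q : List (CStep σ M)) :
    execAll N c (P ++ Q) = execAll N (execAll N c P) Q := by
  induction P generalizing c with
  | nil => rfl
  | cons s P ih => exact ih _

theorem legalAll_append (c : Conf V σ M) (P Q : List (CStep σ M)) :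
    LegalAll N c (P ++ Q) ↔ LegalAll N c P ∧ LegalAll N (execAll N c P) Q := by
  induction P generalizing c with
  | nil => simp [LegalAll, execAll]
  | cons s P ih => simp only [List.cons_append, LegalAll, execAll, ih, and_assoc]

theorem messages_le {c : Conf V σ M} {s : CStep σ M} (h : Legal N c s) :
    messages N c s ≤ 2 * s.rounds * Fintype.card F := by
  classical
  cases s with
  | convergecast op own port upd => exact Nat.zero_le _
  | broadcast msg upd => exact Nat.zero_le _
  | round send =>
    simp only [messages, rounds, mul_one]
    calc _ ≤ (Finset.univ.biUnion fun f =>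
          (N.mwoe f).toFinset ∪ ((N.mwoe f).map Prod.swap).toFinset).card := by
          refine Finset.card_le_card fun e he => ?_
          have he := h e.1 e.2 (Finset.mem_filter.1 he).2
          rw [Finset.mem_biUnion]
          rcases he with ⟨f, -, hf⟩ | ⟨f, -, hf⟩
          · exact ⟨f, Finset.mem_univ _, by rw [hf]; simp⟩
          · exact ⟨f, Finset.mem_univ _, by rw [hf]; simp⟩
      _ ≤ Fintype.card F * 2 := by
          refine Finset.card_biUnion_le_card_mul _ _ _ fun f _ => ?_
          refine (Finset.card_union_le _ _).trans ?_
          have : ∀ o : Option (V × V), o.toFinset.card ≤ 1 := fun o => by cases o <;> simp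
          exact Nat.add_le_add (this _) (this _)
      _ = _ := mul_comm _ _

theorem messagesAll_le {c : Conf V σ M} {P : List (CStep σ M)} (h : LegalAll N c P) :
    messagesAll N c P ≤ 2 * (P.map rounds).sum * Fintype.card F := by
  induction P generalizing c with
  | nil => exact Nat.zero_le _
  | cons s P ih =>
    have h1 := messages_le h.1
    have h2 := ih h.2
    simp only [messagesAll, List.map_cons, List.sum_cons]
    rw [Nat.mul_add, Nat.add_mul]
    omega

end CStep

namespace VStep

open CStep

variable {V F B : Type} [Fintype V] [Fintype F] [Fintype B] {N : Network V F B}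
  {σ M : Type} {k : ℕ}

/-- Communication cycles and rounds over MWOEs simulate sequences of virtual rounds. -/
theorem simulateAll_correct [Fintype M] (hid : ∀ v, N.id v < 2 ^ k) (P : List (VStep σ M))
    {s : F → σ} {c : Conf V (SimState σ M k) (SimMsg M k)}
    (hc : HoldsCopies N (SimState.enc k) s c) :
    LegalAll N c (P.flatMap (simulate k)) ∧ ∃ s', ResultAll N P s s' ∧
      HoldsCopies N (SimState.enc k) s' (execAll N c (P.flatMap (simulate k))) := by
  induction P generalizing s c with
  | nil => exact ⟨trivial, s, rfl, hc⟩
  | cons st P ih =>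
    obtain ⟨h1, t, ht, hct⟩ := simulate_correct hid st hc
    obtain ⟨h2, s', hs', hcs⟩ := ih hct
    rw [List.flatMap_cons, legalAll_append, execAll_append]
    exact ⟨⟨h1, h2⟩, s', ⟨t, ht, hs'⟩, hcs⟩

theorem sum_map_flatMap_le {α β : Type} (f : α → List β) (g : β → ℕ) {b : ℕ}
    (h : ∀ x, ((f x).map g).sum ≤ b) (l : List α) : ((l.flatMap f).map g).sum ≤ b * l.length := by
  induction l with
  | nil => simp
  | cons x l ih =>
    have := h x
    simp only [List.flatMap_cons, List.map_append, List.sum_append, List.length_cons]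
    rw [Nat.mul_succ]
    omega

end VStep

theorem GKP.length_phase_le (a n : ℕ) :
    (GKP.phase ((a + 5) * logBits n) (1 + logStar n) (2 ^ (a + 4) * 2)).length ≤
      (2 ^ (a + 6) + 8) * (logStar n + 1) := by
  rw [GKP.length_phase]
  have : 2 ^ (a + 6) = 4 * 2 ^ (a + 4) := by rw [pow_add, pow_add]; ring
  nlinarith [Nat.zero_le (2 ^ (a + 4) * logStar n)]

theorem claim5p3 :
    -- each of the three kinds of virtual rounds is simulated by `O(1)` communication cycles and
    -- `O(1)` rounds over MWOEs, with messages and additional memory of `O(log n)` bits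
    (∃ C : ℕ, ∀ a : ℕ, ∃ D : ℕ, ∀ (n : ℕ) (σ M : Type) [Fintype σ] [Fintype M],
      Fintype.card M ≤ 2 ^ (a * logBits n) →
      ∀ st : VStep σ M,
        ∃ (σ' M' : Type) (_ : Fintype σ') (_ : Fintype M') (enc : Info → σ → σ') (dec : σ' → σ)
          (P : List (CStep σ' M')),
          (∀ i x, dec (enc i x) = x) ∧
          Fintype.card σ' ≤ Fintype.card σ * 2 ^ (D * logBits n) ∧
          Fintype.card M' ≤ 2 ^ (D * logBits n) ∧
          (P.map CStep.cycles).sum ≤ C ∧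
          (P.map CStep.rounds).sum ≤ C ∧
          Simulates n a enc P st) ∧
    -- a GKP phase takes `O(log* n)` virtual rounds
    (∀ a : ℕ, ∃ C : ℕ, ∀ n : ℕ,
      ∃ (σ M : Type) (_ : Fintype σ) (_ : Fintype M) (start : ℕ → Option ℕ → σ)
        (out : σ → GKPOutput) (P : List (VStep σ M)),
        Fintype.card σ ≤ 2 ^ (C * logBits n) ∧
        Fintype.card M ≤ 2 ^ (C * logBits n) ∧
        P.length ≤ C * (logStar n + 1) ∧
        ∀ (V F B : Type) [Fintype V] [Fintype F] [Fintype B] (N : Network V F B),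
          HasSize N n a →
          ∀ s' : F → σ,
            VStep.ResultAll N P (fun f => start (N.fid f) ((N.parent f).map N.fid)) s' →
            IsGKPOutput N fun f => out (s' f)) ∧
    -- a GKP phase takes `O(log* n)` communication cycles and `O(log* n)` rounds over MWOEs
    (∀ a : ℕ, ∃ C : ℕ, ∀ n : ℕ,
      ∃ (σ M : Type) (_ : Fintype σ) (_ : Fintype M) (start : Info → σ)
        (out : σ → GKPOutput) (P : List (CStep σ M)),
        Fintype.card σ ≤ 2 ^ (C * logBits n) ∧
        Fintype.card M ≤ 2 ^ (C * logBits n) ∧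
        (P.map CStep.cycles).sum ≤ C * (logStar n + 1) ∧
        (P.map CStep.rounds).sum ≤ C * (logStar n + 1) ∧
        ∀ (V F B : Type) [Fintype V] [Fintype F] [Fintype B] (N : Network V F B),
          HasSize N n a →
          ∀ c : Conf V σ M,
            (∀ v f, N.frag v = some f → c.st v = start (N.info v f)) →
            CStep.LegalAll N c P ∧
            CStep.messagesAll N c P ≤ C * (logStar n + 1) * Fintype.card F ∧
            ∃ o : F → GKPOutput, IsGKPOutput N o ∧
              ∀ v f, N.frag v = some f → out ((CStep.execAll N c P).st v) = o f) := by
  refine ⟨⟨4, fun a => ⟨3 * a + 3, fun n σ M _ _ hM st => ?_⟩⟩, fun a => ?_, fun a => ?_⟩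
  · have hL : 1 ≤ logBits n := Nat.le_add_left _ _
    refine ⟨SimState σ M (a * logBits n), SimMsg M (a * logBits n), inferInstance, inferInstance,
      SimState.enc _, SimState.val, st.simulate _, fun _ _ => rfl, SimState.card_le hL hM,
      (SimState.card_simMsg_le hL hM).trans ?_, st.cycles_simulate_le _,
      st.rounds_simulate_le _, ?_⟩
    · exact Nat.pow_le_pow_right (by omega) (Nat.mul_le_mul_right _ (by omega))
    · intro V F B _ _ _ N hN s c hc
      exact VStep.simulate_correct hN.2 st hc
  · refine ⟨2 ^ (a + 6) + 6 * (a + 5) + 8, fun n => ?_⟩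
    have hL : 1 ≤ logBits n := Nat.le_add_left _ _
    refine ⟨GKPState ((a + 5) * logBits n), GKPMsg ((a + 5) * logBits n), inferInstance,
      inferInstance, GKPState.start _, GKPState.out,
      GKP.phase ((a + 5) * logBits n) (1 + logStar n) (2 ^ (a + 4) * 2),
      (GKPState.card_le _).trans ?_, (GKPState.card_msg_le _).trans ?_,
      (GKP.length_phase_le a n).trans (Nat.mul_le_mul_right _ (by omega)), ?_⟩
    · exact Nat.pow_le_pow_right (by omega)
        (by nlinarith [Nat.zero_le (2 ^ (a + 6) * logBits n)])
    · exact Nat.pow_le_pow_right (by omega)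
        (by nlinarith [Nat.zero_le (2 ^ (a + 6) * logBits n), Nat.zero_le ((a + 5) * logBits n)])
    · intro V F B _ _ _ N hN s' hs
      exact GKP.phase_correct rfl hN hs
  · refine ⟨8 * (2 ^ (a + 6) + 8) + 25 * (a + 6), fun n => ?_⟩
    have hL : 1 ≤ logBits n := Nat.le_add_left _ _
    have hlen := GKP.length_phase_le a n
    have hM : Fintype.card (GKPMsg ((a + 5) * logBits n)) ≤ 2 ^ ((a + 6) * logBits n) :=
      (GKPState.card_msg_le _).trans (Nat.pow_le_pow_right (by omega) (by nlinarith))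
    set P := GKP.phase ((a + 5) * logBits n) (1 + logStar n) (2 ^ (a + 4) * 2) with hP
    set k := (a + 6) * logBits n with hk
    have hcyc := VStep.sum_map_flatMap_le (VStep.simulate k) CStep.cycles
      (fun st => VStep.cycles_simulate_le k st) P
    have hrnd := VStep.sum_map_flatMap_le (VStep.simulate k) CStep.rounds
      (fun st => VStep.rounds_simulate_le k st) P
    have hC : 8 * P.length ≤ (8 * (2 ^ (a + 6) + 8) + 25 * (a + 6)) * (logStar n + 1) := by
      nlinarith
    refine ⟨SimState (GKPState ((a + 5) * logBits n)) (GKPMsg ((a + 5) * logBits n)) k,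
      SimMsg (GKPMsg ((a + 5) * logBits n)) k, inferInstance, inferInstance,
      fun i => SimState.enc k i (GKPState.start _ i.fid i.parentFid), fun s => s.val.out,
      P.flatMap (VStep.simulate k), (SimState.card_le hL hM).trans ?_,
      (SimState.card_simMsg_le hL hM).trans ?_, hcyc.trans (by omega), hrnd.trans (by omega), ?_⟩
    · refine (Nat.mul_le_mul_right _ (GKPState.card_le _)).trans ?_
      rw [← pow_add]
      exact Nat.pow_le_pow_right (by omega) (by nlinarith)
    · exact Nat.pow_le_pow_right (by omega) (Nat.mul_le_mul_right _ (by omega))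
    · intro V F B _ _ _ N hN c hc
      have hid : ∀ v, N.id v < 2 ^ k := fun v =>
        (hN.2 v).trans_le (Nat.pow_le_pow_right (by omega) (Nat.mul_le_mul_right _ (by omega)))
      have hc : HoldsCopies N (SimState.enc k)
          (fun f => GKPState.start _ (N.fid f) ((N.parent f).map N.fid)) c := hc
      obtain ⟨hlegal, s', hs, hcs⟩ := VStep.simulateAll_correct hid P hc
      refine ⟨hlegal, (CStep.messagesAll_le hlegal).trans (Nat.mul_le_mul_right _ (by omega)),
        fun f => (s' f).out, GKP.phase_correct rfl hN hs, fun v f hv => ?_⟩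
      rw [hcs v f hv]
      rfl
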